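/- Let $1<p<\infty$ and let $X=(X,d,\mu)$ be a complete, unbounded metric space with a Borel measure $\mu$ such that $0<\mu(B)<\infty$ for every closed ball $B=B(x,r)=\{y : d(x,y)\le r\}$, $r>0$. Assume that $\mu$ is doubling, $\mu(B(x,2r))\le C\mu(B(x,r))$ for all $x\in X$ and $r>0$, and that $X$ supports a $p$-Poincaré inequality: there are $C>0$ and $\lambda\ge1$ such that $$\frac1{\mu(B)}\int_B|f-f_B|\,d\mu\le C\,r\Bigl(\frac1{\mu(\lambda B)}\int_{\lambda B}g^p\,d\mu\Bigr)^{1/p},\qquad f_B=\frac1{\mu(B)}\int_B f\,d\mu,$$ for every ball $B=B(x,r)$, every measurable function $f$ on $X$ that is integrable on $B$, and every upper gradient $g$ of $f$. (A Borel function $g\colon X\to[0,\infty]$ is an upper gradient of $f$ if $|f(y)-f(x)|\le\int_\gamma g\,ds$ for every compact rectifiable curve $\gamma$ in $X$ with endpoints $x,y$.) For $E\subset X$ let $E_r=\{x:\operatorname{dist}(x,E)<r\}$, and let the lower Assouad codimension $\underline{\operatorname{co\,dim}}_A(E)\in[0,\infty]$ be the supremum of all $t\ge0$ for which there is a constant $C$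 with $$\frac{\mu(E_r\cap B(x,R))}{\mu(B(x,R))}\le C\Bigl(\frac rR\Bigr)^t\qquad\text{for all }x\in E\text{ and all }0<r<R<\infty.$$ For an open set $\Omega\subset X$ and $E\subset\Omega$ let $$\operatorname{cap}_p(E,\Omega)=\inf\int_\Omega g^p\,d\mu,$$ where the infimum is over all $u\in N^{1,p}_0(\Omega)$ with $u\ge1$ on $E$ and all upper gradients $g$ of $u$; here $N_0^{1,p}(\Omega)$ consists of the functions $u\in L^p(X)$ which have an upper gradient in $L^p(X)$ and vanish on $\Omega^c=X\setminus\Omega$. If $\Omega\ne X$ and $c>0$, a Whitney cover $\mathcal W_c(\Omega)$ is a countable collection of balls $B(x_i,c\operatorname{dist}(x_i,\Omega^c))$ with centres $x_i\in\Omega$ and union $\Omega$ whose overlap is bounded, i.e. for some $N$ no point belongs to more than $N$ of the balls. The capacity $\operatorname{cap}_p(\cdot,\Omega)$ is quasiadditive with respect to $\mathcal W_c(\Omega)$ if there is a constant $A<\infty$ such that $$\sum_{B\in\mathcal W_c(\Omega)}\operatorname{cap}_p(E\cap B,\Omega)\le A\operatorname{cap}_p(E,\Omega)\qquad\text{for all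 }E\subset\Omega.$$ Then there is $c_0>0$ (depending only on $X$ and $p$) such that for every open set $\Omega\subsetneq X$ with $\underline{\operatorname{co\,dim}}_A(\Omega^c)>p$ and every $0<c\le c_0$, the variational $p$-capacity $\operatorname{cap}_p(\cdot,\Omega)$ is quasiadditive with respect to all Whitney covers $\mathcal W_c(\Omega)$. The constant $A$ may be chosen to depend only on $X$, $p$, $\Omega$, $c$ and the overlap bound $N$. -/

import Mathlib

open MeasureTheory Metric Set
open scoped ENNReal NNReal

namespace QuasiAdd

variable {X : Type*} [MetricSpace X] [MeasurableSpace X]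

/-- Every (closed) ball of positive radius has positive and finite measure. -/
def BallsPosFinite (μ : Measure X) : Prop :=
  ∀ (x : X) (r : ℝ), 0 < r → 0 < μ (closedBall x r) ∧ μ (closedBall x r) < ∞

/-- The measure `μ` is (globally) doubling. -/
def IsDoubling (μ : Measure X) : Prop :=
  ∃ C : ℝ≥0, ∀ (x : X) (r : ℝ), 0 < r → μ (closedBall x (2 * r)) ≤ C * μ (closedBall x r)

/-- `g : X → [0,∞]` is an upper gradient of the real-valued function `u`: it is Borel and
`|u(y) - u(x)| ≤ ∫_γ g ds` for every compact rectifiable curve `γ` with endpoints `x` and `y`.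
Every such curve is taken with its arc-length parametrization `γ : [0,L] → X`
(each piece `γ|[s,t]` has length `t - s`), so that `∫_γ g ds = ∫_0^L g(γ(t)) dt`. -/
def IsUpperGradient (u : X → ℝ) (g : X → ℝ≥0∞) : Prop :=
  Measurable g ∧
    ∀ (γ : ℝ → X) (L : ℝ), 0 ≤ L → HasUnitSpeedOn γ (Icc 0 L) →
      ENNReal.ofReal |u (γ L) - u (γ 0)| ≤ ∫⁻ t in Icc 0 L, g (γ t)

/-- The `(1,p)`-Poincaré inequality: there are `C` and `lam ≥ 1` such that for all balls `B(x,r)`,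
all `μ`-measurable functions `f` (integrable over the ball, so that the mean value `f_B` makes
sense) and all upper gradients `g` of `f`,
`⨍_B |f - f_B| dμ ≤ C r (⨍_{lam B} g^p dμ)^(1/p)`.
Since truncations of `f` keep the upper gradient `g`, it makes no difference that only
real-valued (and not extended real-valued) functions are tested. -/
def SupportsPoincare (μ : Measure X) (p : ℝ) : Prop :=
  ∃ (C : ℝ≥0) (lam : ℝ), 1 ≤ lam ∧
    ∀ (f : X → ℝ) (g : X → ℝ≥0∞), AEMeasurable f μ → IsUpperGradient f g →
      ∀ (x : X) (r : ℝ), 0 < r → IntegrableOn f (closedBall x r) μ →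
        (⨍⁻ y in closedBall x r, ENNReal.ofReal |f y - ⨍ z in closedBall x r, f z ∂μ| ∂μ) ≤
          C * ENNReal.ofReal r * (⨍⁻ y in closedBall x (lam * r), g y ^ p ∂μ) ^ (1 / p)

/-- The exponent `t` is admissible for the lower Assouad codimension of `E`: for some `C`,
`μ(E_r ∩ B(x,R)) / μ(B(x,R)) ≤ C (r/R)^t` for all `x ∈ E` and all `0 < r < R`, where
`E_r` is the open `r`-neighbourhood of `E`.
All radii `R < ∞` are used, in an unbounded space; when `E` is unbounded this is the
range `0 < r < R < diam E`. -/
def IsCodimExponent (μ : Measure X) (E : Set X) (t : ℝ≥0) : Prop :=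
  ∃ C : ℝ≥0, ∀ x ∈ E, ∀ r R : ℝ, 0 < r → r < R →
    μ (thickening r E ∩ closedBall x R) ≤
      C * ENNReal.ofReal ((r / R) ^ (t : ℝ)) * μ (closedBall x R)

/-- The lower Assouad codimension of `E` (in an unbounded space): the supremum of the
admissible exponents `t ≥ 0`. -/
noncomputable def lowerAssouadCodim (μ : Measure X) (E : Set X) : ℝ≥0∞ :=
  ⨆ (t : ℝ≥0) (_ : IsCodimExponent μ E t), (t : ℝ≥0∞)

/-- `u` belongs to the Newtonian space with zero boundary values `N^{1,p}_0(Ω)`: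
`u ∈ L^p(X)` has an upper gradient in `L^p(X)`, and `u = 0` in the complement of `Ω`. -/
def MemNewtonianZero (μ : Measure X) (p : ℝ) (Ω : Set X) (u : X → ℝ) : Prop :=
  MemLp u (ENNReal.ofReal p) μ ∧
    (∃ g : X → ℝ≥0∞, IsUpperGradient u g ∧ ∫⁻ x, g x ^ p ∂μ < ∞) ∧
    ∀ x ∉ Ω, u x = 0

/-- The variational `p`-capacity `cap_p(E,Ω)`: the infimum of `∫_Ω g^p dμ` over all
`u ∈ N^{1,p}_0(Ω)` with `u ≥ 1` on `E` and all upper gradients `g` of `u`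
(it is `∞` if there is no such `u`). -/
noncomputable def variationalCapacity (μ : Measure X) (p : ℝ) (E Ω : Set X) : ℝ≥0∞ :=
  ⨅ (u : X → ℝ) (g : X → ℝ≥0∞)
    (_ : MemNewtonianZero μ p Ω u ∧ (∀ x ∈ E, 1 ≤ u x) ∧ IsUpperGradient u g),
    ∫⁻ x in Ω, g x ^ p ∂μ

/-- The ball `B(x, c dist(x, X ∖ Ω))`. -/
def whitneyBall (Ω : Set X) (c : ℝ) (x : X) : Set X :=
  closedBall x (c * infDist x Ωᶜ)

/-- The set of centres `S` determines a Whitney cover `W_c(Ω)` with overlap at most `N`: the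
balls `B(x, c dist(x, X ∖ Ω))`, `x ∈ S`, are countably many, are centred in `Ω`, have union `Ω`,
and no point belongs to more than `N` of them. -/
structure IsWhitneyCover (Ω : Set X) (c : ℝ) (N : ℕ) (S : Set X) : Prop where
  countable : S.Countable
  subset : S ⊆ Ω
  iUnion_eq : ⋃ x ∈ S, whitneyBall Ω c x = Ω
  overlap : ∀ y : X, {x ∈ S | y ∈ whitneyBall Ω c x}.encard ≤ N

/-- The capacity `cap_p(·,Ω)` is quasiadditive, with constant `A`, with respect to the cover of
`Ω` by the balls `B(x, c dist(x, X ∖ Ω))`, `x ∈ S`. -/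
def IsQuasiadditive (μ : Measure X) (p : ℝ) (Ω : Set X) (c : ℝ) (S : Set X) (A : ℝ≥0) : Prop :=
  ∀ E ⊆ Ω, ∑' x : S, variationalCapacity μ p (E ∩ whitneyBall Ω c (x : X)) Ω ≤
    A * variationalCapacity μ p E Ω

end QuasiAdd

/-!
Write `F = Ωᶜ`, `d = dist(·,F)` and `ν = d⁻ᵖ dμ`. Cutting a function `u ∈ N₀^{1,p}(Ω)` off around
the balls of a Whitney cover costs `Σ ∫_{2B} |u|ᵖ/dᵖ dμ`, so that quasiadditivity follows from a
Hardy inequality. The weak-type inequality `ν{u > 1/2} ≤ A ∫ gᵖ dμ`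
(`CodimBound.exists_hardyMeasure_superlevel_le`) is already enough: the test function
`max(0, min(2u - 1, 2 - d(·,x₀)/ρ))`, where `B = B(x₀,ρ)`, is at least `1` where `u ≥ 1` in `B`,
lives on `{u > 1/2} ∩ 2B`, and has upper gradient `2g + 1/ρ`. As upper gradients are required to
control all curves, the restriction of `2g + 1/ρ` to a Borel set containing the support is an
upper gradient only after adding `εg` (`IsUpperGradient.indicator_add`); then `ε → 0`. The local
estimate is `variationalCapacity_inter_closedBall_le`. The balls `2B` have bounded overlap by the
doubling property.

The weak-type inequality uses the `p`-Poincaré inequality as it stands, without self-improvement.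
The averages of `u` over the balls `B(x, 2ⁿ d(x)/(6λ))`, `n ∈ ℤ`, tend to `u(x)` for almost every
`x` as `n → -∞`, and to `0` as `n → ∞`, because `u ∈ Lᵖ` and `μ(X) = ∞`. If `u(x) > 1/2`, some
increment is therefore larger than a multiple of `θ^|n|`, where `θ < 1` is fixed, and by the
Poincaré inequality the ball `B` of radius `ρ = 2ⁿ d(x)/6` satisfies
`q^|n| ρ⁻ᵖ μ(B) ≤ J ∫_B gᵖ dμ` with `q = θᵖ` (`exists_scale_energy_ge`). For each fixed `n` Vitali's
lemma gives disjoint balls of this type such that every point `y` of this kind is at distance at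
most `3ρ` from a selected centre `x` with `d(y) ≤ 2d(x)`. When `n ≥ 0` such points lie in the
`3d(x)`-neighbourhood of `F`, and since the lower Assouad codimension of `F` exceeds `p`, their
`ν`-measure is at most `K q^(2|n|) ρ⁻ᵖ μ(B)` if `q` is close enough to `1`; when `n ≤ 0` this holds
because `d` is comparable to `d(x)` near `x` (`CodimBound.hardyMeasure_shadow_le`). The gain
`q^(2|n|)` beats the loss `q^(-|n|)`, and the estimates can be summed over `n`.
-/

open Filter Topology

namespace QuasiAdd

/-! ### Upper gradients along arc-length parametrized curves -/

section UpperGradients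

variable {X : Type*} [MetricSpace X]

theorem _root_.HasUnitSpeedOn.shift {γ : ℝ → X} {L s t : ℝ} (h : HasUnitSpeedOn γ (Icc 0 L))
    (hs : 0 ≤ s) (ht : t ≤ L) :
    HasUnitSpeedOn (fun τ => γ (s + τ)) (Icc 0 (t - s)) := by
  intro x hx y hy
  have hmono : MonotoneOn (fun τ : ℝ => s + τ) (Icc 0 (t - s) ∩ Icc x y) :=
    fun a _ b _ hab => by dsimp only; linarith
  have h1 := eVariationOn.comp_eq_of_monotoneOn γ (fun τ : ℝ => s + τ) hmono
  have h2 : (fun τ : ℝ => s + τ) '' (Icc 0 (t - s) ∩ Icc x y)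
      = Icc 0 L ∩ Icc (s + x) (s + y) := by
    ext z
    simp only [mem_image, mem_inter_iff, mem_Icc] at hx hy ⊢
    constructor
    · rintro ⟨τ, ⟨⟨h1, h2⟩, h3, h4⟩, rfl⟩
      exact ⟨⟨by linarith, by linarith⟩, by linarith, by linarith⟩
    · rintro ⟨⟨h1, h2⟩, h3, h4⟩
      exact ⟨z - s, ⟨⟨by linarith, by linarith⟩, by linarith, by linarith⟩, by ring⟩
  simp only [mem_Icc] at hx hy
  rw [h2] at h1
  refine h1.trans ((h ⟨by linarith, by linarith⟩ ⟨by linarith, by linarith⟩).trans ?_)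
  congr 2; ring

theorem _root_.HasUnitSpeedOn.dist_le {γ : ℝ → X} {L s t : ℝ} (h : HasUnitSpeedOn γ (Icc 0 L))
    (hs : s ∈ Icc 0 L) (ht : t ∈ Icc 0 L) (hst : s ≤ t) : dist (γ s) (γ t) ≤ t - s := by
  have h1 := h hs ht
  have h2 := eVariationOn.edist_le γ (s := Icc 0 L ∩ Icc s t) (x := s) (y := t)
    ⟨hs, le_rfl, hst⟩ ⟨ht, hst, le_rfl⟩
  rw [h1, edist_dist] at h2
  have := (ENNReal.ofReal_le_ofReal_iff (by simpa using hst)).1 h2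
  simpa using this

theorem _root_.HasUnitSpeedOn.continuousOn {γ : ℝ → X} {L : ℝ}
    (h : HasUnitSpeedOn γ (Icc 0 L)) : ContinuousOn γ (Icc 0 L) := by
  have : LipschitzOnWith 1 γ (Icc 0 L) := by
    refine LipschitzOnWith.of_dist_le_mul fun s hs t ht => ?_
    rw [NNReal.coe_one, one_mul, Real.dist_eq]
    rcases le_total s t with hst | hst
    · rw [abs_sub_comm]
      exact (h.dist_le hs ht hst).trans (le_abs_self _)
    · rw [dist_comm]
      exact (h.dist_le ht hs hst).trans (le_abs_self _)
  exact this.continuousOn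

variable [MeasurableSpace X]

/-- The upper gradient inequality passes to subcurves. -/
theorem IsUpperGradient.subcurve {u : X → ℝ} {g : X → ℝ≥0∞} (hu : IsUpperGradient u g)
    {γ : ℝ → X} {L s t : ℝ} (h : HasUnitSpeedOn γ (Icc 0 L)) (hs : 0 ≤ s) (hst : s ≤ t)
    (ht : t ≤ L) :
    ENNReal.ofReal |u (γ t) - u (γ s)| ≤ ∫⁻ τ in Icc s t, g (γ τ) := by
  have h1 := hu.2 _ (t - s) (by linarith) (h.shift hs ht)
  simp only [add_sub_cancel, add_zero] at h1
  refine h1.trans_eq ?_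
  have h2 := (measurePreserving_add_left volume s).setLIntegral_comp_emb
    (measurableEmbedding_addLeft s) (fun τ => g (γ τ)) (Icc 0 (t - s))
  rw [image_const_add_Icc, add_zero, add_sub_cancel] at h2
  exact h2

/-- A nonnegative continuous function on an interval realizes its increment over a subinterval on
whose interior it does not vanish. -/
theorem exists_subinterval_ne_zero {f : ℝ → ℝ} {L : ℝ} (hL : 0 ≤ L)
    (hf : ContinuousOn f (Icc 0 L)) (h0 : ∀ t, 0 ≤ f t) :
    ∃ s t, 0 ≤ s ∧ s ≤ t ∧ t ≤ L ∧ |f L - f 0| ≤ |f t - f s| ∧ ∀ τ ∈ Ioo s t, f τ ≠ 0 := by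
  by_cases hz : ∀ τ ∈ Icc 0 L, f τ ≠ 0
  · exact ⟨0, L, le_rfl, hL, le_rfl, le_rfl, fun τ hτ => hz τ ⟨hτ.1.le, hτ.2.le⟩⟩
  push Not at hz
  obtain ⟨τ, hτ, hτ0⟩ := hz
  have hcl : IsCompact (Icc 0 L ∩ f ⁻¹' {0}) :=
    isCompact_Icc.of_isClosed_subset (hf.preimage_isClosed_of_isClosed isClosed_Icc
      isClosed_singleton) inter_subset_left
  have hne : (Icc 0 L ∩ f ⁻¹' {0}).Nonempty := ⟨τ, hτ, hτ0⟩
  rcases le_total (f 0) (f L) with hle | hle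
  · obtain ⟨m, ⟨hm, hm0⟩, hmax⟩ := hcl.exists_isGreatest hne
    refine ⟨m, L, hm.1, hm.2, le_rfl, ?_, fun σ hσ h => ?_⟩
    · rw [mem_preimage, mem_singleton_iff] at hm0
      rw [hm0, sub_zero, abs_of_nonneg (h0 L), abs_of_nonneg (by linarith)]
      linarith [h0 0]
    · exact absurd (hmax ⟨⟨hm.1.trans hσ.1.le, hσ.2.le⟩, h⟩) (not_le.2 hσ.1)
  · obtain ⟨m, ⟨hm, hm0⟩, hmin⟩ := hcl.exists_isLeast hne
    refine ⟨0, m, le_rfl, hm.1, hm.2, ?_, fun σ hσ h => ?_⟩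
    · rw [mem_preimage, mem_singleton_iff] at hm0
      rw [hm0, zero_sub, abs_neg, abs_of_nonneg (h0 0), abs_of_nonpos (by linarith)]
      linarith [h0 L]
    · exact absurd (hmin ⟨⟨hσ.1.le, hσ.2.le.trans hm.2⟩, h⟩) (not_le.2 hσ.2)

/-- An upper gradient of `v ≥ 0` may be set to zero off a Borel set containing `{v ≠ 0}`, at the
cost of adding an arbitrarily small multiple of a function `g` that controls `h` up to a constant.
The added term takes care of the curves along which `h` is not integrable; on all other curves
`v` is continuous. -/
theorem IsUpperGradient.indicator_add [BorelSpace X] {v : X → ℝ} {h g : X → ℝ≥0∞}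
    (hv : IsUpperGradient v h) (hg : Measurable g) (hv0 : ∀ x, 0 ≤ v x) {a K ε : ℝ≥0∞}
    (ha : a ≠ ∞) (hK : K ≠ ∞) (hε : ε ≠ 0) (hle : ∀ x, h x ≤ a * g x + K) {A : Set X}
    (hA : MeasurableSet A) (hvA : ∀ x, v x ≠ 0 → x ∈ A) :
    IsUpperGradient v (fun x => A.indicator h x + ε * g x) := by
  refine ⟨(hv.1.indicator hA).add (hg.const_mul ε), fun γ L hL hγ => ?_⟩
  have hγm : AEMeasurable γ (volume.restrict (Icc 0 L)) := hγ.continuousOn.aemeasurable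
    measurableSet_Icc
  by_cases hfin : ∫⁻ t in Icc 0 L, g (γ t) = ∞
  · have : ∫⁻ t in Icc 0 L, (A.indicator h (γ t) + ε * g (γ t)) = ∞ := by
      rw [eq_top_iff]
      calc ∞ = ε * ∫⁻ t in Icc 0 L, g (γ t) := by rw [hfin, ENNReal.mul_top hε]
        _ = ∫⁻ t in Icc 0 L, ε * g (γ t) :=
            (lintegral_const_mul'' ε (hg.comp_aemeasurable hγm)).symm
        _ ≤ _ := lintegral_mono fun t => le_add_self
    rw [this]; exact le_top
  have hhfin : ∫⁻ t in Icc 0 L, h (γ t) ≠ ∞ := by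
    refine ne_top_of_le_ne_top ?_ (lintegral_mono fun t => hle (γ t))
    rw [lintegral_add_right _ measurable_const, lintegral_const_mul' _ _ ha, lintegral_const]
    refine ENNReal.add_ne_top.2 ⟨ENNReal.mul_ne_top ha hfin, ENNReal.mul_ne_top hK ?_⟩
    simp
  have hcont : ContinuousOn (fun t => v (γ t)) (Icc 0 L) := by
    have hint : IntegrableOn (fun t => (h (γ t)).toReal) (Icc 0 L) :=
      integrable_toReal_of_lintegral_ne_top (hv.1.comp_aemeasurable hγm) hhfin
    have hprim : ContinuousOn (fun t => ∫ τ in (0 : ℝ)..t, (h (γ τ)).toReal) (Icc 0 L) := by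
      have hint' := hint
      rw [← uIcc_of_le hL] at hint' ⊢
      exact intervalIntegral.continuousOn_primitive_interval hint'
    have key : ∀ s ∈ Icc 0 L, ∀ t ∈ Icc 0 L, s ≤ t → |v (γ t) - v (γ s)| ≤
        |(∫ τ in (0 : ℝ)..t, (h (γ τ)).toReal) - ∫ τ in (0 : ℝ)..s, (h (γ τ)).toReal| := by
      intro s hs t ht hst
      have h1 := hv.subcurve hγ hs.1 hst ht.2
      have hsub : Icc s t ⊆ Icc 0 L := Icc_subset_Icc hs.1 ht.2
      have hfin' : ∫⁻ τ in Icc s t, h (γ τ) ≠ ∞ :=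
        ne_top_of_le_ne_top hhfin (lintegral_mono_set hsub)
      have hm' : AEMeasurable (fun τ => h (γ τ)) (volume.restrict (Icc s t)) :=
        (hv.1.comp_aemeasurable hγm).mono_measure (Measure.restrict_mono hsub le_rfl)
      have ii : ∀ r ∈ Icc 0 L, IntervalIntegrable (fun τ => (h (γ τ)).toReal) volume 0 r :=
        fun r hr => (intervalIntegrable_iff_integrableOn_Icc_of_le hr.1).2
          (hint.mono_set (Icc_subset_Icc le_rfl hr.2))
      rw [intervalIntegral.integral_interval_sub_left (ii t ht) (ii s hs),
        intervalIntegral.integral_of_le hst, ← integral_Icc_eq_integral_Ioc,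
        integral_toReal hm' (ae_lt_top' hm' hfin')]
      refine le_trans ?_ (le_abs_self _)
      exact (ENNReal.ofReal_le_iff_le_toReal hfin').1 h1
    rw [Metric.continuousOn_iff] at hprim ⊢
    intro b hb e he
    obtain ⟨δ, hδ, H⟩ := hprim b hb e he
    refine ⟨δ, hδ, fun x hx hxb => lt_of_le_of_lt ?_ (H x hx hxb)⟩
    rw [Real.dist_eq, Real.dist_eq]
    rcases le_total b x with hbx | hbx
    · exact key b hb x hx hbx
    · rw [abs_sub_comm, abs_sub_comm (∫ τ in (0 : ℝ)..x, _)]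
      exact key x hx b hb hbx
  obtain ⟨s, t, hs, hst, ht, hle', hne⟩ := exists_subinterval_ne_zero hL hcont fun t => hv0 _
  calc ENNReal.ofReal |v (γ L) - v (γ 0)| ≤ ENNReal.ofReal |v (γ t) - v (γ s)| :=
        ENNReal.ofReal_le_ofReal hle'
    _ ≤ ∫⁻ τ in Icc s t, h (γ τ) := hv.subcurve hγ hs hst ht
    _ = ∫⁻ τ in Ioo s t, h (γ τ) := setLIntegral_congr Ioo_ae_eq_Icc.symm
    _ ≤ ∫⁻ τ in Ioo s t, (A.indicator h (γ τ) + ε * g (γ τ)) := by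
        refine setLIntegral_mono' measurableSet_Ioo fun τ hτ => ?_
        rw [indicator_of_mem (hvA _ (hne τ hτ))]
        exact le_self_add
    _ ≤ _ := lintegral_mono_set (Ioo_subset_Icc_self.trans (Icc_subset_Icc hs ht))

/-- The function `v = max(0, min(2u - 1, 2 - d(·,x₀)/ρ))`: it lives on `{u > 1/2} ∩ B(x₀, 2ρ)`, and
is at least `1` at the points of `B(x₀,ρ)` where `u ≥ 1`. -/
noncomputable def cutoff (u : X → ℝ) (x₀ : X) (ρ : ℝ) (x : X) : ℝ :=
  max 0 (min (2 * u x - 1) (2 - dist x x₀ / ρ))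

theorem IsUpperGradient.cutoff {u : X → ℝ} {g : X → ℝ≥0∞} (hu : IsUpperGradient u g)
    (x₀ : X) {ρ : ℝ} (hρ : 0 < ρ) :
    IsUpperGradient (cutoff u x₀ ρ) (fun x => 2 * g x + ENNReal.ofReal (1 / ρ)) := by
  refine ⟨(hu.1.const_mul 2).add_const _, fun γ L hL hγ => ?_⟩
  rw [lintegral_add_right _ measurable_const, lintegral_const_mul' _ _ ENNReal.ofNat_ne_top,
    lintegral_const, Measure.restrict_apply_univ, Real.volume_Icc, sub_zero,
    ← ENNReal.ofReal_mul (by positivity)]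
  have h1 := hu.2 γ L hL hγ
  have h2 : dist (γ 0) (γ L) ≤ L := by
    simpa using hγ.dist_le ⟨le_rfl, hL⟩ ⟨hL, le_rfl⟩ hL
  have h3 : |dist (γ L) x₀ / ρ - dist (γ 0) x₀ / ρ| ≤ 1 / ρ * L := by
    rw [← sub_div, abs_div, abs_of_pos hρ, one_div_mul_eq_div]
    gcongr
    refine (abs_dist_sub_le _ _ _).trans ?_
    rwa [dist_comm]
  have h4 : |QuasiAdd.cutoff u x₀ ρ (γ L) - QuasiAdd.cutoff u x₀ ρ (γ 0)| ≤
      2 * |u (γ L) - u (γ 0)| + 1 / ρ * L := by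
    unfold QuasiAdd.cutoff
    have e1 := abs_max_sub_max_le_max 0 (min (2 * u (γ L) - 1) (2 - dist (γ L) x₀ / ρ)) 0
      (min (2 * u (γ 0) - 1) (2 - dist (γ 0) x₀ / ρ))
    have e2 := abs_min_sub_min_le_max (2 * u (γ L) - 1) (2 - dist (γ L) x₀ / ρ)
      (2 * u (γ 0) - 1) (2 - dist (γ 0) x₀ / ρ)
    have e3 : |2 * u (γ L) - 1 - (2 * u (γ 0) - 1)| = 2 * |u (γ L) - u (γ 0)| := by
      rw [show 2 * u (γ L) - 1 - (2 * u (γ 0) - 1) = 2 * (u (γ L) - u (γ 0)) by ring, abs_mul,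
        abs_two]
    have e4 : |2 - dist (γ L) x₀ / ρ - (2 - dist (γ 0) x₀ / ρ)| ≤ 1 / ρ * L := by
      rw [sub_sub_sub_cancel_left, abs_sub_comm]; exact h3
    rw [e3] at e2
    rw [sub_zero, abs_zero] at e1
    have p1 : 0 ≤ 1 / ρ * L := by positivity
    have p2 : 0 ≤ |u (γ L) - u (γ 0)| := abs_nonneg _
    refine e1.trans (max_le (by positivity) (e2.trans (max_le (by linarith) (by linarith))))
  calc _ ≤ ENNReal.ofReal (2 * |u (γ L) - u (γ 0)| + 1 / ρ * L) := ENNReal.ofReal_le_ofReal h4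
    _ = 2 * ENNReal.ofReal |u (γ L) - u (γ 0)| + ENNReal.ofReal (1 / ρ * L) := by
        rw [ENNReal.ofReal_add (by positivity) (by positivity), ENNReal.ofReal_mul zero_le_two,
          ENNReal.ofReal_ofNat]
    _ ≤ _ := by gcongr

end UpperGradients

/-! ### Doubling measures -/

section Measures

variable {X : Type*} [MetricSpace X] [MeasurableSpace X]

theorem measure_closedBall_le_pow {μ : Measure X} {C : ℝ≥0}
    (hC : ∀ (x : X) (r : ℝ), 0 < r → μ (closedBall x (2 * r)) ≤ C * μ (closedBall x r))
    (x y : X) {r R : ℝ} (hr : 0 < r) (k : ℕ) (h : dist y x + R ≤ 2 ^ k * r) :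
    μ (closedBall y R) ≤ C ^ k * μ (closedBall x r) := by
  have key : ∀ k : ℕ, μ (closedBall x (2 ^ k * r)) ≤ C ^ k * μ (closedBall x r) := by
    intro k
    induction k with
    | zero => simp
    | succ k ih =>
      rw [pow_succ', mul_assoc, pow_succ', mul_assoc]
      exact (hC x _ (by positivity)).trans (by gcongr)
  exact (measure_mono (closedBall_subset_closedBall' (by linarith))).trans (key k)

theorem BallsPosFinite.sigmaFinite {μ : Measure X} (hμ : BallsPosFinite μ) : SigmaFinite μ := by
  rcases isEmpty_or_nonempty X with hX | ⟨⟨x₀⟩⟩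
  · have : μ = 0 := Measure.eq_zero_of_isEmpty μ
    rw [this]; infer_instance
  refine ⟨⟨⟨fun n : ℕ => closedBall x₀ (n + 1), fun _ => trivial,
    fun n => (hμ x₀ _ (by positivity)).2, ?_⟩⟩⟩
  refine eq_univ_of_forall fun x => ?_
  obtain ⟨n, hn⟩ := exists_nat_ge (dist x x₀)
  exact mem_iUnion.2 ⟨n, by rw [mem_closedBall]; linarith⟩

theorem BallsPosFinite.isLocallyFiniteMeasure {μ : Measure X} (hμ : BallsPosFinite μ) :
    IsLocallyFiniteMeasure μ :=
  ⟨fun x => ⟨closedBall x 1, closedBall_mem_nhds x one_pos, (hμ x 1 one_pos).2⟩⟩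

theorem IsDoubling.isUnifLocDoublingMeasure {μ : Measure X} (h : IsDoubling μ) :
    IsUnifLocDoublingMeasure μ := by
  obtain ⟨C, hC⟩ := h
  exact ⟨⟨C, by filter_upwards [self_mem_nhdsWithin] with r hr x using hC x r hr⟩⟩

variable [BorelSpace X]

/-- A metric space carrying a measure for which all balls have positive and finite measure is
separable: a disjoint family of balls of positive measure is countable. -/
theorem BallsPosFinite.secondCountableTopology {μ : Measure X} (hμ : BallsPosFinite μ) :
    SecondCountableTopology X := by
  have := hμ.sigmaFinite
  refine Metric.secondCountable_of_almost_dense_set fun ε hε => ?_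
  obtain ⟨s, -, hdis, hs⟩ := Vitali.exists_disjoint_subfamily_covering_enlargement
    (fun x : X => closedBall x (ε / 2)) univ (fun _ => (1 : ℝ)) 2 one_lt_two
    (fun _ _ => zero_le_one) 1 (fun _ _ => le_rfl)
    (fun x _ => nonempty_closedBall.2 (by positivity))
  refine ⟨s, ?_, fun x => ?_⟩
  · have h1 := Measure.countable_meas_pos_of_disjoint_iUnion (μ := μ)
      (As := fun x : s => closedBall (x : X) (ε / 2)) (fun _ => measurableSet_closedBall)
      (fun a b hab => hdis a.2 b.2 (Subtype.coe_injective.ne hab))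
    have h2 : {i : s | 0 < μ (closedBall (i : X) (ε / 2))} = univ :=
      eq_univ_of_forall fun i => (hμ i _ (by positivity)).1
    rw [h2, countable_univ_iff] at h1
    exact h1
  · obtain ⟨y, hy, ⟨z, hz1, hz2⟩, -⟩ := hs x (mem_univ x)
    refine ⟨y, hy, (dist_triangle_right x y z).trans ?_⟩
    rw [mem_closedBall'] at hz1 hz2
    linarith

/-! ### Lower Assouad codimension -/

/-- The inequality defining an admissible exponent `t` of the lower Assouad codimension of `F`,
with an explicit constant. -/
def CodimBound (μ : Measure X) (F : Set X) (t : ℝ) (K : ℝ≥0) : Prop :=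
  ∀ x ∈ F, ∀ r R : ℝ, 0 < r → r < R →
    μ (thickening r F ∩ closedBall x R) ≤ K * ENNReal.ofReal ((r / R) ^ t) * μ (closedBall x R)

omit [BorelSpace X] in
theorem exists_codimBound {μ : Measure X} {F : Set X} {p : ℝ} (hp : 0 ≤ p)
    (h : ENNReal.ofReal p < lowerAssouadCodim μ F) :
    ∃ (t : ℝ) (K : ℝ≥0), p < t ∧ CodimBound μ F t K := by
  unfold lowerAssouadCodim at h
  simp only [lt_iSup_iff] at h
  obtain ⟨t, ⟨K, hK⟩, hpt⟩ := h
  refine ⟨t, K, ?_, hK⟩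
  rw [← ENNReal.ofReal_coe_nnreal] at hpt
  exact (ENNReal.ofReal_lt_ofReal_iff_of_nonneg hp).1 hpt

omit [BorelSpace X] in
/-- A set of positive lower Assouad codimension is a null set. -/
theorem CodimBound.measure_eq_zero {μ : Measure X} (hμ : BallsPosFinite μ) {F : Set X} {t : ℝ}
    {K : ℝ≥0} (ht : 0 < t) (h : CodimBound μ F t K) : μ F = 0 := by
  rcases F.eq_empty_or_nonempty with rfl | ⟨z, hz⟩
  · exact measure_empty
  have key : ∀ n : ℕ, μ (F ∩ closedBall z (n + 1)) = 0 := by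
    intro n
    have hlim : Tendsto (fun r : ℝ => K * ENNReal.ofReal ((r / (n + 1)) ^ t) *
        μ (closedBall z (n + 1))) (𝓝[>] 0) (𝓝 0) := by
      have h1 : Tendsto (fun r : ℝ => (r / (n + 1)) ^ t) (𝓝[>] 0) (𝓝 0) := by
        have : ContinuousAt (fun r : ℝ => (r / (n + 1)) ^ t) 0 :=
          (continuousAt_id.div_const _).rpow_const (Or.inr ht.le)
        have h2 := this.tendsto
        simp only [zero_div, Real.zero_rpow ht.ne'] at h2
        exact h2.mono_left nhdsWithin_le_nhds
      have h2 := ENNReal.tendsto_ofReal h1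
      rw [ENNReal.ofReal_zero] at h2
      have h3 := ENNReal.Tendsto.mul_const (ENNReal.Tendsto.const_mul h2
        (Or.inr (ENNReal.coe_ne_top (r := K)))) (b := μ (closedBall z (n + 1)))
        (Or.inr (hμ z (n + 1) (by positivity)).2.ne)
      simpa using h3
    refine le_antisymm (ge_of_tendsto hlim ?_) bot_le
    have : Ioo (0 : ℝ) (n + 1) ∈ 𝓝[>] (0 : ℝ) := Ioo_mem_nhdsGT (by positivity)
    filter_upwards [this] with r hr
    refine (measure_mono ?_).trans (h z hz r _ hr.1 hr.2)
    exact inter_subset_inter_left _ (self_subset_thickening hr.1 F)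
  have hsub : F ⊆ ⋃ n : ℕ, F ∩ closedBall z (n + 1) := fun x hx => by
    obtain ⟨n, hn⟩ := exists_nat_ge (dist x z)
    exact mem_iUnion.2 ⟨n, hx, by rw [mem_closedBall]; linarith⟩
  exact measure_mono_null hsub (measure_iUnion_null key)

omit [BorelSpace X] in
/-- A nonempty set can have positive lower Assouad codimension (tested at all radii) only in a
space of infinite measure. -/
theorem CodimBound.measure_univ_eq_top {μ : Measure X} (hμ : BallsPosFinite μ) {F : Set X} {t : ℝ}
    {K : ℝ≥0} (ht : 0 < t) (h : CodimBound μ F t K) (hF : F.Nonempty) : μ univ = ∞ := by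
  obtain ⟨z, hz⟩ := hF
  by_contra hfin
  have hlim : Tendsto (fun R : ℝ => K * ENNReal.ofReal ((2 / R) ^ t) * μ univ) atTop (𝓝 0) := by
    have h1 : Tendsto (fun R : ℝ => (2 / R) ^ t) atTop (𝓝 0) := by
      have h2 := (tendsto_const_nhds (x := (2 : ℝ))).div_atTop (tendsto_id (α := ℝ))
      have h3 := h2.rpow_const (p := t) (Or.inr ht.le)
      rwa [Real.zero_rpow ht.ne'] at h3
    have h2 := ENNReal.tendsto_ofReal h1
    rw [ENNReal.ofReal_zero] at h2
    have h3 := ENNReal.Tendsto.mul_const (ENNReal.Tendsto.const_mul h2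
      (Or.inr (ENNReal.coe_ne_top (r := K)))) (b := μ univ) (Or.inr hfin)
    simpa using h3
  refine (hμ z 1 one_pos).1.ne' (le_antisymm (ge_of_tendsto hlim ?_) bot_le)
  filter_upwards [eventually_gt_atTop 2] with R hR
  calc μ (closedBall z 1) ≤ μ (thickening 2 F ∩ closedBall z R) := by
        refine measure_mono fun y hy => ⟨mem_thickening_iff.2 ⟨z, hz, ?_⟩, ?_⟩
        · exact lt_of_le_of_lt hy (by norm_num)
        · exact closedBall_subset_closedBall (by linarith) hy
    _ ≤ _ := h z hz 2 R two_pos hR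
    _ ≤ _ := by gcongr; exact subset_univ _

/-- The measure `ν = dist(·,F)⁻ᵖ dμ` appearing in Hardy's inequality. On the closure of `F` the real
power takes the value `0 ^ (-p) = 0` (for `p ≠ 0`); this does not matter for null sets `F`. -/
noncomputable def hardyMeasure (μ : Measure X) (F : Set X) (p : ℝ) : Measure X :=
  μ.withDensity fun x => ENNReal.ofReal (infDist x F ^ (-p))

omit [BorelSpace X] in
theorem hardyMeasure_le {μ : Measure X} {F : Set X} {p : ℝ} (hp : 0 ≤ p) {T : Set X}
    (hT : MeasurableSet T) {s : ℝ} (hs : 0 < s) (h : ∀ x ∈ T, s ≤ infDist x F) :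
    hardyMeasure μ F p T ≤ ENNReal.ofReal (s ^ (-p)) * μ T := by
  rw [hardyMeasure, withDensity_apply _ hT, ← setLIntegral_const]
  refine setLIntegral_mono' hT fun x hx => ENNReal.ofReal_le_ofReal ?_
  exact Real.rpow_le_rpow_of_nonpos hs (h x hx) (by linarith)

omit [BorelSpace X] in
theorem le_hardyMeasure {μ : Measure X} {F : Set X} {p : ℝ} (hp : 0 ≤ p) {T : Set X}
    (hT : MeasurableSet T) {s : ℝ} (hT0 : ∀ x ∈ T, 0 < infDist x F)
    (h : ∀ x ∈ T, infDist x F ≤ s) :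
    ENNReal.ofReal (s ^ (-p)) * μ T ≤ hardyMeasure μ F p T := by
  rw [hardyMeasure, withDensity_apply _ hT, ← setLIntegral_const]
  refine setLIntegral_mono' hT fun x hx => ENNReal.ofReal_le_ofReal ?_
  exact Real.rpow_le_rpow_of_nonpos (hT0 x hx) (h x hx) (by linarith)

/-- The codimension bound, summed over the layers `2⁻ˡ⁻¹s ≤ dist(·,F) < 2⁻ˡs`. -/
theorem CodimBound.hardyMeasure_thickening_le {μ : Measure X} (hμ : BallsPosFinite μ) {F : Set X}
    (hF : IsClosed F) {t p : ℝ} {K : ℝ≥0} (hp : 0 ≤ p) (hpt : p < t) (h : CodimBound μ F t K) :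
    ∃ K' : ℝ≥0, ∀ z ∈ F, ∀ s R : ℝ, 0 < s → s < R →
      hardyMeasure μ F p (thickening s F ∩ closedBall z R) ≤
        K' * ENNReal.ofReal ((s / R) ^ t * s ^ (-p)) * μ (closedBall z R) := by
  set a : ℝ := (1 / 2) ^ (t - p) with ha
  have ha0 : 0 ≤ a := by positivity
  have ha1 : a < 1 := Real.rpow_lt_one (by norm_num) (by norm_num) (by linarith)
  have hsum : ∑' l : ℕ, ENNReal.ofReal (a ^ l) ≠ ∞ :=
    (summable_geometric_of_lt_one ha0 ha1).tsum_ofReal_ne_top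
  refine ⟨K * Real.toNNReal (2 ^ p) * (∑' l : ℕ, ENNReal.ofReal (a ^ l)).toNNReal,
    fun z hz s R hs hsR => ?_⟩
  have hR : 0 < R := hs.trans hsR
  -- on `F` itself the weight is a junk value, but `F` is a null set
  have hnull : hardyMeasure μ F p F = 0 :=
    withDensity_absolutelyContinuous _ _ (h.measure_eq_zero hμ (by linarith))
  set T : ℕ → Set X := fun l =>
    {x | (1 / 2) ^ (l + 1) * s ≤ infDist x F} ∩ (thickening ((1 / 2) ^ l * s) F ∩ closedBall z R)
    with hT
  have hTm : ∀ l, MeasurableSet (T l) := fun l =>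
    (isClosed_le continuous_const (continuous_infDist_pt F)).measurableSet.inter
      (isOpen_thickening.measurableSet.inter measurableSet_closedBall)
  have hcover : thickening s F ∩ closedBall z R ⊆ F ∪ ⋃ l, T l := by
    rintro x ⟨hx1, hx2⟩
    by_cases hxF : x ∈ F
    · exact Or.inl hxF
    have hd : 0 < infDist x F := (hF.notMem_iff_infDist_pos ⟨z, hz⟩).1 hxF
    have hex : ∃ n : ℕ, (1 / 2 : ℝ) ^ (n + 1) * s ≤ infDist x F := by
      obtain ⟨n, hn⟩ := exists_pow_lt_of_lt_one (div_pos hd hs) (by norm_num : (1 / 2 : ℝ) < 1)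
      refine ⟨n, ((le_div_iff₀ hs).1 (le_trans ?_ hn.le))⟩
      exact pow_le_pow_of_le_one (by norm_num) (by norm_num) n.le_succ
    classical
    refine Or.inr (mem_iUnion.2 ⟨Nat.find hex, Nat.find_spec hex, ?_, hx2⟩)
    rcases hn : Nat.find hex with _ | n
    · simpa using hx1
    · have := Nat.find_min hex (m := n) (by omega)
      rw [mem_thickening_iff_infDist_lt ⟨z, hz⟩]
      exact not_le.1 this
  have hlayer : ∀ l, hardyMeasure μ F p (T l) ≤ K * ENNReal.ofReal (2 ^ p) *
      ENNReal.ofReal ((s / R) ^ t * s ^ (-p)) * μ (closedBall z R) * ENNReal.ofReal (a ^ l) := by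
    intro l
    have hb : (0 : ℝ) < (1 / 2) ^ l := by positivity
    have hsl : (1 / 2) ^ l * s ≤ s :=
      mul_le_of_le_one_left hs.le (pow_le_one₀ (by norm_num) (by norm_num))
    have hreal : ((1 / 2) ^ (l + 1) * s) ^ (-p) * ((1 / 2) ^ l * s / R) ^ t
        = 2 ^ p * ((s / R) ^ t * s ^ (-p)) * a ^ l := by
      have e1 : ((1 / 2 : ℝ) ^ (l + 1) * s) ^ (-p) =
          ((1 / 2) ^ l) ^ (-p) * 2 ^ p * s ^ (-p) := by
        rw [pow_succ, Real.mul_rpow (by positivity) hs.le, Real.mul_rpow hb.le (by norm_num),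
          one_div 2, Real.inv_rpow zero_le_two (-p), Real.rpow_neg zero_le_two, inv_inv]
      have e2 : ((1 / 2 : ℝ) ^ l * s / R) ^ t = ((1 / 2) ^ l) ^ t * (s / R) ^ t := by
        rw [mul_div_assoc, Real.mul_rpow hb.le (by positivity)]
      have e3 : a ^ l = ((1 / 2 : ℝ) ^ l) ^ (-p) * ((1 / 2) ^ l) ^ t := by
        rw [ha, ← Real.rpow_natCast, ← Real.rpow_mul (by norm_num), ← Real.rpow_add hb,
          ← Real.rpow_natCast, ← Real.rpow_mul (by norm_num)]
        congr 1; ring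
      rw [e1, e2, e3]; ring
    calc hardyMeasure μ F p (T l)
        ≤ ENNReal.ofReal (((1 / 2) ^ (l + 1) * s) ^ (-p)) * μ (T l) :=
          hardyMeasure_le hp (hTm l) (by positivity) fun x hx => hx.1
      _ ≤ ENNReal.ofReal (((1 / 2) ^ (l + 1) * s) ^ (-p)) *
          (K * ENNReal.ofReal (((1 / 2) ^ l * s / R) ^ t) * μ (closedBall z R)) := by
          gcongr
          exact (measure_mono inter_subset_right).trans
            (h z hz _ R (by positivity) (hsl.trans_lt hsR))
      _ = K * ENNReal.ofReal (((1 / 2) ^ (l + 1) * s) ^ (-p) * ((1 / 2) ^ l * s / R) ^ t) *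
          μ (closedBall z R) := by
          rw [ENNReal.ofReal_mul (by positivity)]; ring
      _ = _ := by
          rw [hreal, ENNReal.ofReal_mul (by positivity), ENNReal.ofReal_mul (by positivity)]
          ring
  calc hardyMeasure μ F p (thickening s F ∩ closedBall z R)
      ≤ hardyMeasure μ F p F + ∑' l, hardyMeasure μ F p (T l) :=
        (measure_mono hcover).trans ((measure_union_le _ _).trans
          (by gcongr; exact measure_iUnion_le _))
    _ ≤ ∑' l, K * ENNReal.ofReal (2 ^ p) * ENNReal.ofReal ((s / R) ^ t * s ^ (-p)) *
        μ (closedBall z R) * ENNReal.ofReal (a ^ l) := by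
        rw [hnull, zero_add]; exact ENNReal.tsum_le_tsum hlayer
    _ = _ := by
        rw [ENNReal.tsum_mul_left]
        push_cast
        rw [ENNReal.coe_toNNReal hsum]
        change _ = (K : ℝ≥0∞) * ENNReal.ofReal (2 ^ p) * _ * _ * _
        ring

end Measures

/-! ### Telescoping averages -/

section Averages

variable {X : Type*} [MetricSpace X] [MeasurableSpace X]

/-- If a two-sided sequence changes by more than the total mass of the geometric weights
`δ θ^|n|`, then one of its increments exceeds the corresponding weight. -/
theorem exists_increment_gt {s : ℤ → ℝ} {ℓ δ θ : ℝ} (hθ0 : 0 < θ) (hθ1 : θ < 1) (hδ : 0 < δ)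
    (htop : Tendsto s atTop (𝓝 0)) (hbot : Tendsto s atBot (𝓝 ℓ))
    (hℓ : 2 * δ * (1 - θ)⁻¹ < |ℓ|) :
    ∃ n : ℤ, δ * θ ^ n.natAbs < |s n - s (n - 1)| := by
  by_contra! hcon
  have hsum : HasSum (fun n : ℕ => δ * θ ^ n) (δ * (1 - θ)⁻¹) :=
    (hasSum_geometric_of_lt_one hθ0.le hθ1).mul_left δ
  have h1 : dist (s ((0 : ℕ) : ℤ)) 0 ≤ δ * (1 - θ)⁻¹ := by
    rw [← hsum.tsum_eq]
    refine dist_le_tsum_of_dist_le_of_tendsto₀ (f := fun n : ℕ => s (n : ℤ)) _ (fun n => ?_)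
      hsum.summable (htop.comp tendsto_natCast_atTop_atTop)
    have h2 := hcon ((n : ℤ) + 1)
    rw [dist_comm, Real.dist_eq]
    rw [show ((n : ℤ) + 1).natAbs = n + 1 by omega, add_sub_cancel_right] at h2
    rw [Nat.succ_eq_add_one, Nat.cast_add, Nat.cast_one]
    refine h2.trans ?_
    gcongr δ * ?_
    exact pow_le_pow_of_le_one hθ0.le hθ1.le n.le_succ
  have h2 : dist (s (-((0 : ℕ) : ℤ))) ℓ ≤ δ * (1 - θ)⁻¹ := by
    rw [← hsum.tsum_eq]
    refine dist_le_tsum_of_dist_le_of_tendsto₀ (f := fun n : ℕ => s (-(n : ℤ))) _ (fun n => ?_)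
      hsum.summable (hbot.comp (tendsto_neg_atTop_atBot.comp tendsto_natCast_atTop_atTop))
    have h2 := hcon (-(n : ℤ))
    rw [Real.dist_eq]
    rw [show (-(n : ℤ)).natAbs = n by omega] at h2
    rw [Nat.succ_eq_add_one, Nat.cast_add, Nat.cast_one, neg_add]
    exact h2
  simp only [Nat.cast_zero, neg_zero, Real.dist_eq, sub_zero] at h1 h2
  have h3 : |ℓ| ≤ |s 0| + |s 0 - ℓ| := by
    have := abs_sub (s 0) (s 0 - ℓ)
    rwa [sub_sub_cancel] at this
  linarith

omit [MetricSpace X] in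
theorem ofReal_abs_average_sub_le {μ : Measure X} {s : Set X} (h0 : μ s ≠ 0) (htop : μ s ≠ ∞)
    {f : X → ℝ} (hf : IntegrableOn f s μ) (c : ℝ) :
    ENNReal.ofReal |(⨍ y in s, f y ∂μ) - c| ≤ ⨍⁻ y in s, ENNReal.ofReal |f y - c| ∂μ := by
  rw [setAverage_eq', setLAverage_eq']
  have : IsProbabilityMeasure ((μ s)⁻¹ • μ.restrict s) :=
    ⟨by simp [ENNReal.inv_mul_cancel h0 htop]⟩
  have hint : Integrable f ((μ s)⁻¹ • μ.restrict s) :=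
    Integrable.smul_measure hf (ENNReal.inv_ne_top.2 h0)
  have h1 : (∫ y, f y ∂((μ s)⁻¹ • μ.restrict s)) - c =
      ∫ y, (f y - c) ∂((μ s)⁻¹ • μ.restrict s) := by
    rw [integral_sub hint (integrable_const c), integral_const, probReal_univ, one_smul]
  rw [h1]
  simpa only [← Real.norm_eq_abs, ofReal_norm] using
    enorm_integral_le_lintegral_enorm (fun y => f y - c)

/-- The Poincaré inequality bounds the change of the average when the radius is halved. -/
theorem SupportsPoincare.exists_average_sub_le {μ : Measure X} {p : ℝ} (hμ : BallsPosFinite μ)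
    (hD : IsDoubling μ) (hP : SupportsPoincare μ p) :
    ∃ (K : ℝ≥0) (lam : ℝ), 1 ≤ lam ∧ ∀ (f : X → ℝ) (g : X → ℝ≥0∞), AEMeasurable f μ →
      IsUpperGradient f g → ∀ (x : X) (r : ℝ), 0 < r → IntegrableOn f (closedBall x r) μ →
        ENNReal.ofReal |(⨍ y in closedBall x r, f y ∂μ) - ⨍ y in closedBall x (r / 2), f y ∂μ| ≤
          K * ENNReal.ofReal r * (⨍⁻ y in closedBall x (lam * r), g y ^ p ∂μ) ^ (1 / p) := by
  obtain ⟨C, hC⟩ := hD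
  obtain ⟨CP, lam, hlam, hP⟩ := hP
  refine ⟨C * CP, lam, hlam, fun f g hf hg x r hr hint => ?_⟩
  have hr2 : 0 < r / 2 := by positivity
  have hsub : closedBall x (r / 2) ⊆ closedBall x r := closedBall_subset_closedBall (by linarith)
  have hpos := hμ x _ hr2
  have hpos' := hμ x _ hr
  set c := ⨍ y in closedBall x r, f y ∂μ
  have hd := hC x _ hr2
  rw [mul_div_cancel₀ _ two_ne_zero] at hd
  have hinv : (μ (closedBall x (r / 2)))⁻¹ ≤ C * (μ (closedBall x r))⁻¹ := by
    rw [← div_eq_mul_inv, ENNReal.le_div_iff_mul_le (Or.inl hpos'.1.ne') (Or.inl hpos'.2.ne),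
      ← ENNReal.div_eq_inv_mul]
    exact ENNReal.div_le_of_le_mul hd
  calc ENNReal.ofReal |c - ⨍ y in closedBall x (r / 2), f y ∂μ|
      = ENNReal.ofReal |(⨍ y in closedBall x (r / 2), f y ∂μ) - c| := by rw [abs_sub_comm]
    _ ≤ ⨍⁻ y in closedBall x (r / 2), ENNReal.ofReal |f y - c| ∂μ :=
        ofReal_abs_average_sub_le hpos.1.ne' hpos.2.ne (hint.mono_set hsub) c
    _ = (μ (closedBall x (r / 2)))⁻¹ *
          ∫⁻ y in closedBall x (r / 2), ENNReal.ofReal |f y - c| ∂μ := by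
        rw [setLAverage_eq, ENNReal.div_eq_inv_mul]
    _ ≤ C * (μ (closedBall x r))⁻¹ * ∫⁻ y in closedBall x r, ENNReal.ofReal |f y - c| ∂μ := by
        gcongr
    _ = C * ⨍⁻ y in closedBall x r, ENNReal.ofReal |f y - c| ∂μ := by
        rw [setLAverage_eq, ENNReal.div_eq_inv_mul, mul_assoc]
    _ ≤ C * (CP * ENNReal.ofReal r *
        (⨍⁻ y in closedBall x (lam * r), g y ^ p ∂μ) ^ (1 / p)) := by
        gcongr
        exact hP f g hf hg x r hr hint
    _ = _ := by push_cast; ring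

theorem integrableOn_closedBall_of_memLp {μ : Measure X} (hμ : BallsPosFinite μ) {p : ℝ}
    (hp : 1 ≤ p) {u : X → ℝ} (hu : MemLp u (ENNReal.ofReal p) μ) (x : X) {r : ℝ} (hr : 0 < r) :
    IntegrableOn u (closedBall x r) μ := by
  have : IsFiniteMeasure (μ.restrict (closedBall x r)) :=
    ⟨by rw [Measure.restrict_apply_univ]; exact (hμ x r hr).2⟩
  exact (hu.restrict _).integrable (by simpa using ENNReal.ofReal_le_ofReal hp)

/-- In a space of infinite measure, the averages of an `Lᵖ` function over growing balls
tend to zero. -/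
theorem tendsto_average_atTop {μ : Measure X} (hμ : BallsPosFinite μ) (hinf : μ univ = ∞) {p : ℝ}
    (hp : 1 < p) {u : X → ℝ} (hu : MemLp u (ENNReal.ofReal p) μ) (x : X) :
    Tendsto (fun r : ℝ => ⨍ y in closedBall x r, u y ∂μ) atTop (𝓝 0) := by
  have hp0 : 0 < p := by linarith
  set I := ∫⁻ y, ENNReal.ofReal |u y| ^ p ∂μ with hI
  have hIfin : I ≠ ∞ := by
    have := lintegral_rpow_enorm_lt_top_of_eLpNorm_lt_top (by simpa using hp0) ENNReal.ofReal_ne_top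
      hu.2
    rw [ENNReal.toReal_ofReal hp0.le] at this
    simpa only [hI, ← Real.norm_eq_abs, ofReal_norm] using this.ne
  have hbound : ∀ᶠ r : ℝ in atTop, ENNReal.ofReal |⨍ y in closedBall x r, u y ∂μ| ≤
      ((μ (closedBall x r))⁻¹ * I) ^ (1 / p) := by
    filter_upwards [eventually_gt_atTop 0] with r hr
    have hpos := hμ x r hr
    have h1 := ofReal_abs_average_sub_le hpos.1.ne' hpos.2.ne
      (integrableOn_closedBall_of_memLp hμ hp.le hu x hr) 0
    simp only [sub_zero] at h1
    rw [setLAverage_eq'] at h1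
    have : IsProbabilityMeasure ((μ (closedBall x r))⁻¹ • μ.restrict (closedBall x r)) :=
      ⟨by simp [ENNReal.inv_mul_cancel hpos.1.ne' hpos.2.ne]⟩
    have hm : AEMeasurable (fun y => ENNReal.ofReal |u y|)
        ((μ (closedBall x r))⁻¹ • μ.restrict (closedBall x r)) := by
      have h2 : AEMeasurable u (μ.restrict (closedBall x r)) := hu.1.aemeasurable.restrict
      have h3 : AEMeasurable (fun y => |u y|) (μ.restrict (closedBall x r)) := by
        simpa only [Real.norm_eq_abs] using h2.norm
      exact h3.ennreal_ofReal.smul_measure _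
    have h2 := ENNReal.lintegral_mul_le_Lp_mul_Lq _ (Real.HolderConjugate.conjExponent hp) hm
      (aemeasurable_const (b := (1 : ℝ≥0∞)))
    simp only [Pi.mul_apply, mul_one, ENNReal.one_rpow, lintegral_one, measure_univ] at h2
    refine (h1.trans h2).trans ?_
    rw [lintegral_smul_measure, smul_eq_mul]
    gcongr
    exact setLIntegral_le_lintegral _ _
  have hball : Tendsto (fun r : ℝ => μ (closedBall x r)) atTop (𝓝 ∞) := by
    have h1 := tendsto_measure_iUnion_atTop (μ := μ) (s := fun r : ℝ => closedBall x r)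
      (fun a b hab => closedBall_subset_closedBall hab)
    have h2 : ⋃ r : ℝ, closedBall x r = univ :=
      eq_univ_of_forall fun y => mem_iUnion.2 ⟨dist y x, mem_closedBall.2 le_rfl⟩
    rwa [h2, hinf] at h1
  have hlim : Tendsto (fun r : ℝ => ((μ (closedBall x r))⁻¹ * I) ^ (1 / p)) atTop (𝓝 0) := by
    have h1 := ENNReal.Tendsto.mul_const (tendsto_inv_iff.2 hball) (b := I) (Or.inr hIfin)
    rw [ENNReal.inv_top, zero_mul] at h1
    have h2 := h1.ennrpow_const (1 / p)
    rwa [ENNReal.zero_rpow_of_pos (by positivity)] at h2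
  have h0 : Tendsto (fun r : ℝ => ENNReal.ofReal |⨍ y in closedBall x r, u y ∂μ|) atTop (𝓝 0) :=
    tendsto_of_tendsto_of_tendsto_of_le_of_le' tendsto_const_nhds hlim
      (Eventually.of_forall fun _ => bot_le) hbound
  have h1 := (ENNReal.tendsto_toReal ENNReal.zero_ne_top).comp h0
  simp only [Function.comp_def, ENNReal.toReal_ofReal (abs_nonneg _), ENNReal.toReal_zero] at h1
  exact (tendsto_zero_iff_abs_tendsto_zero _).2 h1

variable [BorelSpace X]

/-- Almost every point of `{u > 1/2}` at positive distance from `F` is the centre of a ball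
comparable, up to a factor `2ⁿ`, to its distance from `F`, on which the energy of `u` is at least a
multiple of `q^|n| ρ⁻ᵖ μ(B)`. -/
theorem exists_scale_energy_ge {μ : Measure X} (hμ : BallsPosFinite μ) (hD : IsDoubling μ) {p : ℝ}
    (hp : 1 < p) (hP : SupportsPoincare μ p) (hinf : μ univ = ∞) {q : ℝ} (hq0 : 0 < q)
    (hq1 : q < 1) :
    ∃ J : ℝ≥0, ∀ (F : Set X) (u : X → ℝ) (g : X → ℝ≥0∞), MemLp u (ENNReal.ofReal p) μ →
      IsUpperGradient u g → ∀ᵐ x ∂μ, 1 / 2 < u x → 0 < infDist x F →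
        ∃ n : ℤ, ENNReal.ofReal (q ^ n.natAbs * (2 ^ n * infDist x F / 6) ^ (-p)) *
            μ (closedBall x (2 ^ n * infDist x F / 6)) ≤
          J * ∫⁻ y in closedBall x (2 ^ n * infDist x F / 6), g y ^ p ∂μ := by
  have hp0 : 0 < p := by linarith
  obtain ⟨K, lam, hlam, hK⟩ := hP.exists_average_sub_le hμ hD
  have := hμ.secondCountableTopology
  have := hμ.isLocallyFiniteMeasure
  have := hD.isUnifLocDoublingMeasure
  set θ : ℝ := q ^ (1 / p) with hθ
  have hθ0 : 0 < θ := by positivity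
  have hθ1 : θ < 1 := Real.rpow_lt_one hq0.le hq1 (by positivity)
  -- the weights `δ θ^|n|` have total mass at most `2δ/(1 - θ) = 1/4 < 1/2`
  set δ : ℝ := (1 - θ) / 8 with hδ
  have hδ0 : 0 < δ := by rw [hδ]; linarith
  refine ⟨K ^ p * Real.toNNReal (δ ^ (-p)), fun F u g hu hg => ?_⟩
  have hloc : LocallyIntegrable u μ := fun x =>
    ⟨closedBall x 1, closedBall_mem_nhds x one_pos,
      integrableOn_closedBall_of_memLp hμ hp.le hu x one_pos⟩
  filter_upwards [IsUnifLocDoublingMeasure.ae_tendsto_average μ hloc 1] with x hx hux hd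
  set d := infDist x F
  have hlam0 : 0 < lam := by linarith
  set r : ℤ → ℝ := fun n => 2 ^ n * d / 6 / lam with hr
  have hr0 : ∀ n, 0 < r n := fun n => by positivity
  have hzpow_bot : Tendsto (fun n : ℤ => (2 : ℝ) ^ n) atBot (𝓝 0) := by
    have h := (tendsto_rpow_atBot_of_base_gt_one 2 one_lt_two).comp (tendsto_intCast_atBot_iff.2
      (tendsto_id (α := ℤ)))
    simpa [Function.comp_def, Real.rpow_intCast] using h
  have hrtop : Tendsto r atTop atTop := by
    have h1 : Tendsto (fun n : ℤ => (2 : ℝ) ^ n) atTop atTop := by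
      have h := (tendsto_rpow_atTop_of_base_gt_one 2 one_lt_two).comp
        (tendsto_intCast_atTop_iff.2 (tendsto_id (α := ℤ)))
      simpa [Function.comp_def, Real.rpow_intCast] using h
    exact ((h1.atTop_mul_const hd).atTop_div_const (by norm_num)).atTop_div_const hlam0
  have hrbot : Tendsto r atBot (𝓝[>] 0) := by
    refine tendsto_nhdsWithin_iff.2 ⟨?_, Eventually.of_forall hr0⟩
    have := ((hzpow_bot.mul_const d).div_const 6).div_const lam
    simpa using this
  obtain ⟨n, hn⟩ := exists_increment_gt (s := fun n => ⨍ y in closedBall x (r n), u y ∂μ)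
    (ℓ := u x) hθ0 hθ1 hδ0 ((tendsto_average_atTop hμ hinf hp hu x).comp hrtop)
    (hx (fun _ => x) r hrbot (Eventually.of_forall fun n =>
      mem_closedBall_self (by rw [one_mul]; exact (hr0 n).le))) (by
      have : (1 - θ) ≠ 0 := by linarith
      have e : 2 * δ * (1 - θ)⁻¹ = 1 / 4 := by rw [hδ]; field_simp; norm_num
      rw [e]
      have := le_abs_self (u x)
      linarith)
  refine ⟨n, ?_⟩
  set ρ : ℝ := 2 ^ n * d / 6 with hρ
  have hρ0 : 0 < ρ := by positivity
  have hrn : r n = ρ / lam := rfl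
  have hrle : r n ≤ ρ := div_le_self hρ0.le hlam
  have hrn1 : r (n - 1) = r n / 2 := by
    simp only [hr]; rw [zpow_sub_one₀ two_ne_zero]; ring
  have h1 := hK u g hu.1.aemeasurable hg x (r n) (hr0 n)
    (integrableOn_closedBall_of_memLp hμ hp.le hu x (hr0 n))
  rw [hrn1] at hn
  have hball : lam * r n = ρ := by rw [hrn]; field_simp
  rw [hball] at h1
  have h2 : ENNReal.ofReal (δ * θ ^ n.natAbs) ≤ K * ENNReal.ofReal ρ *
      (⨍⁻ y in closedBall x ρ, g y ^ p ∂μ) ^ (1 / p) :=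
    (ENNReal.ofReal_le_ofReal hn.le).trans (h1.trans (by gcongr))
  have hpos := hμ x ρ hρ0
  have h3 := ENNReal.rpow_le_rpow h2 hp0.le
  rw [ENNReal.mul_rpow_of_nonneg _ _ hp0.le, ENNReal.mul_rpow_of_nonneg _ _ hp0.le,
    ← ENNReal.rpow_mul, one_div_mul_cancel hp0.ne', ENNReal.rpow_one,
    ENNReal.ofReal_rpow_of_nonneg (by positivity) hp0.le,
    ENNReal.ofReal_rpow_of_nonneg hρ0.le hp0.le, setLAverage_eq,
    Real.mul_rpow hδ0.le (by positivity)] at h3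
  have hθq : (θ ^ n.natAbs) ^ p = q ^ n.natAbs := by
    rw [hθ, ← Real.rpow_natCast, ← Real.rpow_mul (by positivity), ← Real.rpow_mul (by positivity),
      ← Real.rpow_natCast]
    congr 1; field_simp
  rw [hθq] at h3
  set I := ∫⁻ y in closedBall x ρ, g y ^ p ∂μ
  have e1 : ENNReal.ofReal (q ^ n.natAbs * ρ ^ (-p)) =
      ENNReal.ofReal (δ ^ (-p)) * ENNReal.ofReal (ρ ^ (-p)) *
        ENNReal.ofReal (δ ^ p * q ^ n.natAbs) := by
    rw [← ENNReal.ofReal_mul (by positivity), ← ENNReal.ofReal_mul (by positivity)]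
    congr 1
    rw [Real.rpow_neg hδ0.le]
    have : δ ^ p ≠ 0 := by positivity
    field_simp
  have e2 : ENNReal.ofReal (ρ ^ (-p)) * ENNReal.ofReal (ρ ^ p) = 1 := by
    rw [← ENNReal.ofReal_mul (by positivity), ← Real.rpow_add hρ0, neg_add_cancel, Real.rpow_zero,
      ENNReal.ofReal_one]
  rw [e1]
  calc ENNReal.ofReal (δ ^ (-p)) * ENNReal.ofReal (ρ ^ (-p)) *
        ENNReal.ofReal (δ ^ p * q ^ n.natAbs) * μ (closedBall x ρ)
      ≤ ENNReal.ofReal (δ ^ (-p)) * ENNReal.ofReal (ρ ^ (-p)) *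
        (K ^ p * ENNReal.ofReal (ρ ^ p) * (I / μ (closedBall x ρ))) * μ (closedBall x ρ) := by
        gcongr
    _ = (ENNReal.ofReal (ρ ^ (-p)) * ENNReal.ofReal (ρ ^ p)) * (K ^ p * ENNReal.ofReal (δ ^ (-p)) *
        (I / μ (closedBall x ρ) * μ (closedBall x ρ))) := by ring
    _ = K ^ p * ENNReal.ofReal (δ ^ (-p)) * I := by
        rw [e2, one_mul, ENNReal.div_mul_cancel hpos.1.ne' hpos.2.ne]
    _ = _ := by
        rw [ENNReal.coe_mul, ENNReal.coe_rpow_of_nonneg _ hp0.le]; rfl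

end Averages

/-! ### A weak-type Hardy inequality -/

section Hardy

variable {X : Type*} [MetricSpace X] [MeasurableSpace X] [BorelSpace X]

/-- The points covered through the ball `B(x,ρ)`, `ρ = 2ⁿ dist(x,F)/6`, in Vitali's lemma. Their
`ν`-measure has the factor `q^(2|n|)`: for `n ≥ 0` this is the codimension bound in a ball that
is large compared to `dist(x,F)`. The factor `1/6` makes `3ρ ≤ dist(x,F)/2` for `n ≤ 0`, so that on
this set the distance to `F` is then at least `dist(x,F)/2`. -/
theorem CodimBound.hardyMeasure_shadow_le {μ : Measure X} (hμ : BallsPosFinite μ)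
    (hD : IsDoubling μ) {F : Set X} (hF : IsClosed F) (hne : F.Nonempty) {t p : ℝ} {K : ℝ≥0}
    (hp : 0 ≤ p) (hpt : p < t) (h : CodimBound μ F t K) {q : ℝ}
    (hq1 : (1 / 2) ^ (t - p) ≤ q ^ 2) (hq2 : (1 / 2) ^ p ≤ q ^ 2) :
    ∃ K' : ℝ≥0, ∀ (n : ℤ) (x : X) (ρ : ℝ), 0 < infDist x F → ρ = 2 ^ n * infDist x F / 6 →
      hardyMeasure μ F p {y | dist y x ≤ 3 * ρ ∧ infDist y F ≤ 2 * infDist x F} ≤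
        K' * ENNReal.ofReal (q ^ n.natAbs * (q ^ n.natAbs * ρ ^ (-p))) * μ (closedBall x ρ) := by
  obtain ⟨C, hC⟩ := hD
  obtain ⟨K₁, hK₁⟩ := h.hardyMeasure_thickening_le hμ hF hp hpt
  refine ⟨K₁ * C ^ 6 + C ^ 2, fun n x ρ hx hρ => ?_⟩
  set d := infDist x F
  set T := {y | dist y x ≤ 3 * ρ ∧ infDist y F ≤ 2 * d} with hT
  have hρ0 : 0 < ρ := by rw [hρ]; positivity
  have ht0 : 0 ≤ t := hp.trans hpt.le
  have hb : ∀ m : ℕ, (0 : ℝ) < (1 / 2) ^ m := fun m => by positivity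
  have hbpow : ∀ (m : ℕ) (s : ℝ), (1 / 2 : ℝ) ^ s ≤ q ^ 2 →
      ((1 / 2 : ℝ) ^ m) ^ s ≤ q ^ m * q ^ m := by
    intro m s hs
    calc ((1 / 2 : ℝ) ^ m) ^ s = ((1 / 2 : ℝ) ^ s) ^ m := by
          rw [← Real.rpow_natCast, ← Real.rpow_natCast, ← Real.rpow_mul (by norm_num),
            ← Real.rpow_mul (by norm_num), mul_comm]
      _ ≤ (q ^ 2) ^ m := by gcongr
      _ = q ^ m * q ^ m := by ring
  have hcoe : ((K₁ * C ^ 6 + C ^ 2 : ℝ≥0) : ℝ≥0∞) = K₁ * (C : ℝ≥0∞) ^ 6 + (C : ℝ≥0∞) ^ 2 := by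
    push_cast; rfl
  rcases Int.eq_nat_or_neg n with ⟨m, rfl | rfl⟩
  · rw [Int.natAbs_natCast]
    rw [zpow_natCast] at hρ
    have hm1 : (1 : ℝ) ≤ 2 ^ m := one_le_pow₀ one_le_two
    have hdρ : d ≤ 6 * ρ := by rw [hρ]; nlinarith
    obtain ⟨z, hz, hxz⟩ := (infDist_lt_iff hne).1 (show infDist x F < 2 * d by linarith)
    have hsub : T ⊆ thickening (3 * d) F ∩ closedBall z (30 * ρ) := by
      rintro y ⟨hy1, hy2⟩
      refine ⟨(mem_thickening_iff_infDist_lt hne).2 (by linarith), ?_⟩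
      rw [mem_closedBall]
      linarith [dist_triangle y x z]
    have hball : μ (closedBall z (30 * ρ)) ≤ C ^ 6 * μ (closedBall x ρ) := by
      refine measure_closedBall_le_pow hC x z hρ0 6 ?_
      rw [dist_comm]; linarith
    have hreal : (3 * d / (30 * ρ)) ^ t * (3 * d) ^ (-p) ≤ q ^ m * (q ^ m * ρ ^ (-p)) := by
      have hd : d = 6 * ρ * (1 / 2) ^ m := by
        rw [hρ]; field_simp; rw [← mul_pow]; norm_num
      have e1 : 3 * d / (30 * ρ) = 3 / 5 * (1 / 2) ^ m := by
        rw [hd]; field_simp; ring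
      have e2 : 3 * d = 18 * ρ * (1 / 2) ^ m := by rw [hd]; ring
      rw [e1, e2, Real.mul_rpow (by norm_num) (hb m).le, Real.mul_rpow (by positivity) (hb m).le]
      have i1 : (3 / 5 : ℝ) ^ t ≤ 1 := Real.rpow_le_one (by norm_num) (by norm_num) ht0
      have i2 : (18 * ρ) ^ (-p) ≤ ρ ^ (-p) :=
        Real.rpow_le_rpow_of_nonpos hρ0 (by linarith) (by linarith)
      have i3 := hbpow m _ hq1
      calc (3 / 5 : ℝ) ^ t * ((1 / 2) ^ m) ^ t * ((18 * ρ) ^ (-p) * ((1 / 2) ^ m) ^ (-p))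
          = (3 / 5 : ℝ) ^ t * (18 * ρ) ^ (-p) * ((1 / 2 : ℝ) ^ m) ^ (t - p) := by
            rw [sub_eq_add_neg, Real.rpow_add (hb m)]; ring
        _ ≤ 1 * ρ ^ (-p) * (q ^ m * q ^ m) := by gcongr
        _ = _ := by ring
    calc hardyMeasure μ F p T
        ≤ K₁ * ENNReal.ofReal ((3 * d / (30 * ρ)) ^ t * (3 * d) ^ (-p)) *
          μ (closedBall z (30 * ρ)) := by
          refine (measure_mono hsub).trans (hK₁ z hz _ _ (by positivity) ?_)
          linarith
      _ ≤ K₁ * ENNReal.ofReal (q ^ m * (q ^ m * ρ ^ (-p))) * (C ^ 6 * μ (closedBall x ρ)) := by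
          gcongr
      _ = K₁ * C ^ 6 * ENNReal.ofReal (q ^ m * (q ^ m * ρ ^ (-p))) * μ (closedBall x ρ) := by ring
      _ ≤ _ := by
          rw [hcoe]
          gcongr
          exact le_self_add
  · rw [Int.natAbs_neg, Int.natAbs_natCast]
    rw [zpow_neg, zpow_natCast] at hρ
    have hm1 : (1 : ℝ) ≤ 2 ^ m := one_le_pow₀ one_le_two
    have hd : d / 2 = 3 * ρ * 2 ^ m := by rw [hρ]; field_simp; norm_num
    have hTm : MeasurableSet T :=
      ((isClosed_le (continuous_id.dist continuous_const) continuous_const).inter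
        (isClosed_le (continuous_infDist_pt F) continuous_const)).measurableSet
    have hball : μ T ≤ C ^ 2 * μ (closedBall x ρ) := by
      refine (measure_mono fun y hy => hy.1).trans
        (measure_closedBall_le_pow hC x x hρ0 2 (R := 3 * ρ) ?_)
      rw [dist_self]; linarith
    have hreal : (d / 2) ^ (-p) ≤ q ^ m * (q ^ m * ρ ^ (-p)) := by
      rw [hd, Real.mul_rpow (by positivity) (by positivity)]
      have i2 : (3 * ρ) ^ (-p) ≤ ρ ^ (-p) :=
        Real.rpow_le_rpow_of_nonpos hρ0 (by linarith) (by linarith)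
      have i3 := hbpow m _ hq2
      have e : ((2 : ℝ) ^ m) ^ (-p) = ((1 / 2 : ℝ) ^ m) ^ p := by
        rw [Real.rpow_neg (by positivity), ← Real.inv_rpow (by positivity), one_div, inv_pow]
      rw [e]
      calc (3 * ρ) ^ (-p) * ((1 / 2 : ℝ) ^ m) ^ p ≤ ρ ^ (-p) * (q ^ m * q ^ m) := by gcongr
        _ = _ := by ring
    calc hardyMeasure μ F p T ≤ ENNReal.ofReal ((d / 2) ^ (-p)) * μ T := by
          refine hardyMeasure_le hp hTm (by positivity) fun y hy => ?_
          have h1 := infDist_le_infDist_add_dist (s := F) (x := x) (y := y)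
          have h2 := hy.1
          rw [dist_comm] at h2
          have h3 : 3 * ρ ≤ d / 2 := by rw [hd]; nlinarith
          change d / 2 ≤ infDist y F
          change d ≤ _ at h1
          linarith
      _ ≤ ENNReal.ofReal (q ^ m * (q ^ m * ρ ^ (-p))) * (C ^ 2 * μ (closedBall x ρ)) := by
          gcongr
      _ = C ^ 2 * ENNReal.ofReal (q ^ m * (q ^ m * ρ ^ (-p))) * μ (closedBall x ρ) := by ring
      _ ≤ _ := by
          rw [hcoe]
          gcongr
          exact le_add_self

/-- If every point of `E` is the centre of a ball of radius `2ⁿ dist(x,F)/6` carrying enough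
energy, then a disjoint subfamily of these balls bounds the `ν`-measure of `E`. -/
theorem hardyMeasure_le_of_scale {μ : Measure X} (hμ : BallsPosFinite μ) {F : Set X} {p q : ℝ}
    (hq0 : 0 < q) {K J : ℝ≥0} (n : ℤ)
    (hK : ∀ (x : X) (ρ : ℝ), 0 < infDist x F → ρ = 2 ^ n * infDist x F / 6 →
      hardyMeasure μ F p {y | dist y x ≤ 3 * ρ ∧ infDist y F ≤ 2 * infDist x F} ≤
        K * ENNReal.ofReal (q ^ n.natAbs * (q ^ n.natAbs * ρ ^ (-p))) * μ (closedBall x ρ))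
    {h : X → ℝ≥0∞} {E : Set X} (hE0 : ∀ x ∈ E, 0 < infDist x F)
    (hE : ∀ x ∈ E, ENNReal.ofReal (q ^ n.natAbs * (2 ^ n * infDist x F / 6) ^ (-p)) *
        μ (closedBall x (2 ^ n * infDist x F / 6)) ≤
          J * ∫⁻ y in closedBall x (2 ^ n * infDist x F / 6), h y ∂μ) :
    hardyMeasure μ F p E ≤ K * J * ENNReal.ofReal (q ^ n.natAbs) * ∫⁻ y, h y ∂μ := by
  have := hμ.sigmaFinite
  set ρ : X → ℝ := fun x => 2 ^ n * infDist x F / 6 with hρ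
  have hρ0 : ∀ x ∈ E, 0 < ρ x := fun x hx => by
    have := hE0 x hx
    positivity
  have hn0 : (0 : ℝ) < 2 ^ n := by positivity
  -- Vitali's lemma needs bounded radii
  have key : ∀ M : ℕ, hardyMeasure μ F p (E ∩ {x | infDist x F ≤ M}) ≤
      K * J * ENNReal.ofReal (q ^ n.natAbs) * ∫⁻ y, h y ∂μ := by
    intro M
    obtain ⟨s, hsE, hdis, hs⟩ := Vitali.exists_disjoint_subfamily_covering_enlargement
      (fun x : X => closedBall x (ρ x)) (E ∩ {x | infDist x F ≤ M}) ρ 2 one_lt_two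
      (fun x hx => (hρ0 x hx.1).le) (2 ^ n * M / 6)
      (fun x hx => by
        have : infDist x F ≤ M := hx.2
        simp only [hρ]; gcongr)
      (fun x hx => nonempty_closedBall.2 (hρ0 x hx.1).le)
    have hdis' : Pairwise (Function.onFun Disjoint fun x : s => closedBall (x : X) (ρ x)) :=
      fun a b hab => hdis a.2 b.2 (Subtype.coe_injective.ne hab)
    have hcount : Countable s := by
      have h1 := Measure.countable_meas_pos_of_disjoint_iUnion (μ := μ)
        (As := fun x : s => closedBall (x : X) (ρ x)) (fun _ => measurableSet_closedBall) hdis'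
      have h2 : {i : s | 0 < μ (closedBall (i : X) (ρ i))} = univ :=
        eq_univ_of_forall fun i => (hμ i _ (hρ0 i (hsE i.2).1)).1
      rwa [h2, countable_univ_iff] at h1
    have hcover : E ∩ {x | infDist x F ≤ M} ⊆
        ⋃ x : s, {y | dist y x ≤ 3 * ρ x ∧ infDist y F ≤ 2 * infDist (x : X) F} := by
      intro y hy
      obtain ⟨b, hb, ⟨z, hz1, hz2⟩, hle⟩ := hs y hy
      refine mem_iUnion.2 ⟨⟨b, hb⟩, ?_, ?_⟩
      · rw [mem_closedBall'] at hz1 hz2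
        have := dist_triangle_right y b z
        change dist y b ≤ 3 * ρ b
        linarith
      · change infDist y F ≤ 2 * infDist b F
        simp only [hρ] at hle
        have : 2 ^ n * infDist y F ≤ 2 ^ n * (2 * infDist b F) := by linarith
        exact le_of_mul_le_mul_left this hn0
    calc hardyMeasure μ F p (E ∩ {x | infDist x F ≤ M})
        ≤ ∑' x : s, hardyMeasure μ F p
            {y | dist y x ≤ 3 * ρ x ∧ infDist y F ≤ 2 * infDist (x : X) F} :=
          (measure_mono hcover).trans (measure_iUnion_le _)
      _ ≤ ∑' x : s, K * J * ENNReal.ofReal (q ^ n.natAbs) *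
            ∫⁻ y in closedBall (x : X) (ρ x), h y ∂μ := by
          refine ENNReal.tsum_le_tsum fun x => ?_
          have hx := (hsE x.2).1
          calc _ ≤ K * ENNReal.ofReal (q ^ n.natAbs * (q ^ n.natAbs * ρ x ^ (-p))) *
                μ (closedBall (x : X) (ρ x)) := hK x (ρ x) (hE0 x hx) rfl
            _ = K * ENNReal.ofReal (q ^ n.natAbs) *
                (ENNReal.ofReal (q ^ n.natAbs * ρ x ^ (-p)) * μ (closedBall (x : X) (ρ x))) := by
                rw [ENNReal.ofReal_mul (by positivity)]; ring
            _ ≤ K * ENNReal.ofReal (q ^ n.natAbs) *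
                (J * ∫⁻ y in closedBall (x : X) (ρ x), h y ∂μ) := by
                exact mul_le_mul' le_rfl (hE x hx)
            _ = _ := by ring
      _ = K * J * ENNReal.ofReal (q ^ n.natAbs) *
            ∫⁻ y in ⋃ x : s, closedBall (x : X) (ρ x), h y ∂μ := by
          rw [ENNReal.tsum_mul_left, lintegral_iUnion (fun _ => measurableSet_closedBall) hdis']
      _ ≤ _ := by
          exact mul_le_mul' le_rfl (setLIntegral_le_lintegral _ _)
  have hE' : E = ⋃ M : ℕ, E ∩ {x | infDist x F ≤ M} := by
    rw [← inter_iUnion, eq_comm, inter_eq_left]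
    intro x _
    obtain ⟨M, hM⟩ := exists_nat_ge (infDist x F)
    exact mem_iUnion.2 ⟨M, hM⟩
  have hmono : Monotone fun M : ℕ => E ∩ {x | infDist x F ≤ M} := by
    intro a b hab
    refine inter_subset_inter_right _ fun x (hx : infDist x F ≤ a) => ?_
    exact hx.trans (Nat.cast_le.2 hab)
  rw [hE', hmono.measure_iUnion]
  exact iSup_le key

/-- The weak-type Hardy inequality `ν{u > 1/2} ≤ A ∫ gᵖ dμ`, where `ν = dist(·,F)⁻ᵖ dμ`, for a
closed set `F` of lower Assouad codimension greater than `p`. -/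
theorem CodimBound.exists_hardyMeasure_superlevel_le {μ : Measure X} (hμ : BallsPosFinite μ)
    (hD : IsDoubling μ) {p : ℝ} (hp : 1 < p) (hP : SupportsPoincare μ p) {F : Set X}
    (hF : IsClosed F) (hne : F.Nonempty) {t : ℝ} {K : ℝ≥0} (hpt : p < t)
    (h : CodimBound μ F t K) :
    ∃ A : ℝ≥0, ∀ (u : X → ℝ) (g : X → ℝ≥0∞), MemLp u (ENNReal.ofReal p) μ → IsUpperGradient u g →
      hardyMeasure μ F p {x | 1 / 2 < u x} ≤ A * ∫⁻ x, g x ^ p ∂μ := by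
  have hp0 : 0 < p := by linarith
  set σ := min (t - p) p with hσ
  have hσ0 : 0 < σ := lt_min (by linarith) hp0
  set q : ℝ := (1 / 2) ^ (σ / 2) with hq
  have hq0 : 0 < q := by positivity
  have hq1 : q < 1 := Real.rpow_lt_one (by norm_num) (by norm_num) (by positivity)
  have hq2 : q ^ 2 = (1 / 2) ^ σ := by
    rw [hq, ← Real.rpow_natCast, ← Real.rpow_mul (by norm_num)]
    congr 1; push_cast; ring
  obtain ⟨K', hK'⟩ := h.hardyMeasure_shadow_le hμ hD hF hne hp0.le hpt
    (by rw [hq2]; exact Real.rpow_le_rpow_of_exponent_ge (by norm_num) (by norm_num)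
          (min_le_left _ _))
    (by rw [hq2]; exact Real.rpow_le_rpow_of_exponent_ge (by norm_num) (by norm_num)
          (min_le_right _ _))
  have hinf := h.measure_univ_eq_top hμ (hp0.trans hpt) hne
  obtain ⟨J, hJ⟩ := exists_scale_energy_ge hμ hD hp hP hinf hq0 hq1
  have hsum : ∑' n : ℤ, ENNReal.ofReal (q ^ n.natAbs) ≠ ∞ := by
    have hg := summable_geometric_of_lt_one hq0.le hq1
    refine Summable.tsum_ofReal_ne_top (Summable.of_nat_of_neg ?_ ?_) <;> simpa using hg
  refine ⟨K' * J * (∑' n : ℤ, ENNReal.ofReal (q ^ n.natAbs)).toNNReal, fun u g hu hg => ?_⟩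
  set E : ℤ → Set X := fun n => {x | 0 < infDist x F ∧
    ENNReal.ofReal (q ^ n.natAbs * (2 ^ n * infDist x F / 6) ^ (-p)) *
      μ (closedBall x (2 ^ n * infDist x F / 6)) ≤
    J * ∫⁻ y in closedBall x (2 ^ n * infDist x F / 6), g y ^ p ∂μ} with hE
  have hac : hardyMeasure μ F p ≪ μ := withDensity_absolutelyContinuous _ _
  have hnull : hardyMeasure μ F p F = 0 := hac (h.measure_eq_zero hμ (hp0.trans hpt))
  have hle : {x | 1 / 2 < u x} ≤ᵐ[hardyMeasure μ F p] ⋃ n, E n := by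
    filter_upwards [hac.ae_le (hJ F u g hu hg), measure_eq_zero_iff_ae_notMem.1 hnull]
      with x hx hxF hux
    have hd : 0 < infDist x F := (hF.notMem_iff_infDist_pos hne).1 hxF
    obtain ⟨n, hn⟩ := hx hux hd
    exact mem_iUnion.2 ⟨n, hd, hn⟩
  calc hardyMeasure μ F p {x | 1 / 2 < u x} ≤ hardyMeasure μ F p (⋃ n, E n) := measure_mono_ae hle
    _ ≤ ∑' n, hardyMeasure μ F p (E n) := measure_iUnion_le _
    _ ≤ ∑' n : ℤ, K' * J * ENNReal.ofReal (q ^ n.natAbs) * ∫⁻ x, g x ^ p ∂μ :=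
        ENNReal.tsum_le_tsum fun n => hardyMeasure_le_of_scale hμ hq0 n (hK' n)
          (fun x hx => hx.1) fun x hx => hx.2
    _ = _ := by
        rw [ENNReal.tsum_mul_right, ENNReal.tsum_mul_left, ENNReal.coe_mul,
          ENNReal.coe_toNNReal hsum, ENNReal.coe_mul]

end Hardy

/-! ### Overlap of enlarged Whitney balls -/

section Whitney

variable {X : Type*} [MetricSpace X] [MeasurableSpace X] [BorelSpace X]

omit [MetricSpace X] [BorelSpace X] in
theorem tsum_setLIntegral_le_of_overlap {ι : Type*} [Countable ι] (μ : Measure X) {T : ι → Set X}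
    (hT : ∀ i, MeasurableSet (T i)) {M : ℝ≥0∞}
    (hM : ∀ y, ∑' i, (T i).indicator (1 : X → ℝ≥0∞) y ≤ M) {f : X → ℝ≥0∞} (hf : Measurable f) :
    ∑' i, ∫⁻ y in T i, f y ∂μ ≤ M * ∫⁻ y, f y ∂μ := by
  calc ∑' i, ∫⁻ y in T i, f y ∂μ = ∑' i, ∫⁻ y, f y * (T i).indicator (1 : X → ℝ≥0∞) y ∂μ := by
        congr 1; ext i
        rw [← lintegral_indicator (hT i)]
        congr 1; ext y
        by_cases hy : y ∈ T i <;> simp [hy]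
    _ = ∫⁻ y, ∑' i, f y * (T i).indicator (1 : X → ℝ≥0∞) y ∂μ :=
        (lintegral_tsum fun i => (hf.mul (measurable_one.indicator (hT i))).aemeasurable).symm
    _ ≤ ∫⁻ y, M * f y ∂μ := by
        refine lintegral_mono fun y => ?_
        rw [ENNReal.tsum_mul_left, mul_comm]
        gcongr
        exact hM y
    _ = M * ∫⁻ y, f y ∂μ := lintegral_const_mul _ hf

omit [MeasurableSpace X] [BorelSpace X] in
theorem IsWhitneyCover.tsum_indicator_le {Ω S : Set X} {c : ℝ} {N : ℕ}
    (hS : IsWhitneyCover Ω c N S) (y : X) :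
    ∑' x : S, (whitneyBall Ω c (x : X)).indicator (1 : X → ℝ≥0∞) y ≤ N := by
  have h1 : ∑' x : S, (whitneyBall Ω c (x : X)).indicator (1 : X → ℝ≥0∞) y =
      ∑' x : {x ∈ S | y ∈ whitneyBall Ω c x}, (1 : ℝ≥0∞) := by
    rw [tsum_subtype S fun x => (whitneyBall Ω c x).indicator (1 : X → ℝ≥0∞) y,
      tsum_subtype {x ∈ S | y ∈ whitneyBall Ω c x} fun _ => (1 : ℝ≥0∞)]
    congr 1; ext x
    by_cases hx : x ∈ S <;> by_cases hy : y ∈ whitneyBall Ω c x <;> simp [hx, hy]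
  rw [h1, ENNReal.tsum_set_one]
  exact_mod_cast hS.overlap y

omit [MeasurableSpace X] [BorelSpace X] in
theorem infDist_le_and_le_of_mem_closedBall {F : Set X} {c : ℝ} (hc1 : c ≤ 1 / 4) {x y : X}
    (hy : y ∈ closedBall x (2 * (c * infDist x F))) :
    infDist x F ≤ 2 * infDist y F ∧ infDist y F ≤ 3 / 2 * infDist x F := by
  have h1 := infDist_le_infDist_add_dist (s := F) (x := x) (y := y)
  have h2 := infDist_le_infDist_add_dist (s := F) (x := y) (y := x)
  rw [dist_comm] at h1
  rw [mem_closedBall] at hy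
  have h3 : (0 : ℝ) ≤ infDist x F := infDist_nonneg
  constructor <;> nlinarith

/-- The doubled balls of a Whitney cover have bounded overlap: those containing `y` come from
original balls of comparable measure in one ball around `y`. -/
theorem IsWhitneyCover.tsum_indicator_double_le {μ : Measure X} (hμ : BallsPosFinite μ) {C : ℝ≥0}
    (hC : ∀ (x : X) (r : ℝ), 0 < r → μ (closedBall x (2 * r)) ≤ C * μ (closedBall x r))
    {Ω S : Set X} (hΩ : IsOpen Ω) (hne : Ωᶜ.Nonempty) {c : ℝ} (hc : 0 < c) (hc1 : c ≤ 1 / 4)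
    {N : ℕ} (hS : IsWhitneyCover Ω c N S) (y : X) :
    ∑' x : S, (closedBall (x : X) (2 * (c * infDist (x : X) Ωᶜ))).indicator
      (1 : X → ℝ≥0∞) y ≤ C ^ 4 * N := by
  have := hS.countable.to_subtype
  have hd : ∀ x : S, 0 < infDist (x : X) Ωᶜ := fun x =>
    (hΩ.isClosed_compl.notMem_iff_infDist_pos hne).1 fun h => h (hS.subset x.2)
  rcases (infDist_nonneg (s := Ωᶜ) (x := y)).eq_or_lt with hy0 | hy0
  · have : ∀ x : S, (closedBall (x : X) (2 * (c * infDist (x : X) Ωᶜ))).indicator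
        (1 : X → ℝ≥0∞) y = 0 := fun x => indicator_of_notMem (fun h => by
      have := (infDist_le_and_le_of_mem_closedBall hc1 h).1
      linarith [hd x]) _
    simp [this]
  set D := infDist y Ωᶜ
  set R := 6 * (c * D)
  have hR : 0 < R := by positivity
  have hB := hμ y R hR
  have hterm : ∀ x : S, (closedBall (x : X) (2 * (c * infDist (x : X) Ωᶜ))).indicator
      (1 : X → ℝ≥0∞) y * μ (closedBall y R) ≤
      C ^ 4 * ∫⁻ z in whitneyBall Ω c (x : X), (closedBall y R).indicator 1 z ∂μ := by
    intro x
    by_cases hx : y ∈ closedBall (x : X) (2 * (c * infDist (x : X) Ωᶜ))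
    · obtain ⟨h1, h2⟩ := infDist_le_and_le_of_mem_closedBall hc1 hx
      rw [mem_closedBall] at hx
      have hcx : 0 < c * infDist (x : X) Ωᶜ := mul_pos hc (hd x)
      have h1' : c * infDist (x : X) Ωᶜ ≤ c * (2 * D) := by gcongr
      have h2' : c * D ≤ c * (3 / 2 * infDist (x : X) Ωᶜ) := by gcongr
      have hsub : whitneyBall Ω c (x : X) ⊆ closedBall y R := by
        refine closedBall_subset_closedBall' ?_
        rw [dist_comm]
        linarith
      rw [indicator_of_mem (mem_closedBall.2 hx), Pi.one_apply, one_mul,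
        setLIntegral_congr_fun (g := 1)
          (show MeasurableSet (whitneyBall Ω c (x : X)) from measurableSet_closedBall)
          (fun z hz => indicator_of_mem (hsub hz) _)]
      simp only [Pi.one_apply, lintegral_one, Measure.restrict_apply_univ]
      refine measure_closedBall_le_pow hC x y hcx 4 ?_
      linarith
    · rw [indicator_of_notMem hx, zero_mul]; exact bot_le
  have hsum : (∑' x : S, (closedBall (x : X) (2 * (c * infDist (x : X) Ωᶜ))).indicator
      (1 : X → ℝ≥0∞) y) * μ (closedBall y R) ≤ C ^ 4 * N * μ (closedBall y R) := by
    rw [← ENNReal.tsum_mul_right]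
    refine (ENNReal.tsum_le_tsum hterm).trans ?_
    rw [ENNReal.tsum_mul_left, mul_assoc]
    gcongr
    refine (tsum_setLIntegral_le_of_overlap μ (fun x : S => measurableSet_closedBall)
      hS.tsum_indicator_le (measurable_one.indicator measurableSet_closedBall)).trans_eq ?_
    rw [lintegral_indicator_one measurableSet_closedBall]
  exact (ENNReal.mul_le_mul_iff_left hB.1.ne' hB.2.ne).1 hsum

/-! ### Localizing a test function to a Whitney ball -/

omit [BorelSpace X] [MeasurableSpace X] in
theorem mem_of_cutoff_ne_zero {u : X → ℝ} {x₀ : X} {ρ : ℝ} (hρ : 0 < ρ) {x : X}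
    (h : cutoff u x₀ ρ x ≠ 0) : 1 / 2 < u x ∧ x ∈ closedBall x₀ (2 * ρ) := by
  have h1 : 0 < min (2 * u x - 1) (2 - dist x x₀ / ρ) := by
    by_contra hle
    exact h (max_eq_left (not_lt.1 hle))
  rw [lt_min_iff] at h1
  refine ⟨by linarith, ?_⟩
  rw [mem_closedBall, ← div_le_iff₀ hρ]
  linarith

theorem memLp_cutoff {μ : Measure X} {q : ℝ≥0∞} {u : X → ℝ} (hu : MemLp u q μ) (x₀ : X) (ρ : ℝ) :
    MemLp (cutoff u x₀ ρ) q μ := by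
  have hm : AEMeasurable (cutoff u x₀ ρ) μ := by
    have h1 := hu.1.aemeasurable
    have h2 : Measurable fun x => 2 - dist x x₀ / ρ :=
      (continuous_const.sub ((continuous_id.dist continuous_const).div_const _)).measurable
    exact aemeasurable_const.max (((h1.const_mul 2).sub_const 1).min h2.aemeasurable)
  refine hu.of_le_mul (c := 2) hm.aestronglyMeasurable (Eventually.of_forall fun x => ?_)
  rw [Real.norm_eq_abs, Real.norm_eq_abs, cutoff, abs_of_nonneg (le_max_left _ _)]
  refine max_le (by positivity) ((min_le_left _ _).trans ?_)
  linarith [le_abs_self (u x)]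

/-- The capacity of the part of `{u ≥ 1}` in the ball `B(x₀,ρ)`, estimated with the test function
`cutoff u x₀ ρ`; no values of `u` enter, only the measure of `{u > 1/2} ∩ B(x₀,2ρ)`. -/
theorem variationalCapacity_inter_closedBall_le {μ : Measure X} (hμ : BallsPosFinite μ) {p : ℝ}
    (hp : 1 < p) {Ω E : Set X} {u : X → ℝ} {g : X → ℝ≥0∞} (hu : MemNewtonianZero μ p Ω u)
    (hE : ∀ x ∈ E, 1 ≤ u x) (hg : IsUpperGradient u g) (hgfin : ∫⁻ x, g x ^ p ∂μ ≠ ∞) {H : Set X}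
    (hH : MeasurableSet H) (huH : ∀ x, 1 / 2 < u x → x ∈ H) (x₀ : X) {ρ : ℝ} (hρ : 0 < ρ) :
    variationalCapacity μ p (E ∩ closedBall x₀ ρ) Ω ≤
      2 ^ (p - 1) * 2 ^ (p - 1) * (2 ^ p * ∫⁻ x in closedBall x₀ (2 * ρ), g x ^ p ∂μ +
        ENNReal.ofReal (ρ ^ (-p)) * μ (H ∩ closedBall x₀ (2 * ρ))) := by
  have hp0 : 0 < p := by linarith
  set T := H ∩ closedBall x₀ (2 * ρ) with hT
  have hTm : MeasurableSet T := hH.inter measurableSet_closedBall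
  have hTfin : μ T ≠ ∞ :=
    ne_top_of_le_ne_top (hμ x₀ (2 * ρ) (by positivity)).2.ne (measure_mono inter_subset_right)
  set I := ∫⁻ x, g x ^ p ∂μ
  set h : X → ℝ≥0∞ := fun x => 2 * g x + ENNReal.ofReal (1 / ρ) with hh
  have hgp : Measurable fun x => g x ^ p := hg.1.pow_const p
  have htwo : (2 : ℝ≥0∞) ^ (p - 1) ≠ ∞ :=
    ENNReal.rpow_ne_top_of_nonneg (by linarith) ENNReal.ofNat_ne_top
  have htwo' : (2 : ℝ≥0∞) ^ p ≠ ∞ := ENNReal.rpow_ne_top_of_nonneg hp0.le ENNReal.ofNat_ne_top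
  set Q := 2 ^ p * (∫⁻ x in closedBall x₀ (2 * ρ), g x ^ p ∂μ) + ENNReal.ofReal (ρ ^ (-p)) * μ T
    with hQ
  have hQfin : Q ≠ ∞ := by
    refine ENNReal.add_ne_top.2 ⟨ENNReal.mul_ne_top htwo' ?_,
      ENNReal.mul_ne_top ENNReal.ofReal_ne_top hTfin⟩
    exact ne_top_of_le_ne_top hgfin (setLIntegral_le_lintegral _ _)
  have henergy : ∀ ε : ℝ≥0∞, ∫⁻ x, (T.indicator h x + ε * g x) ^ p ∂μ ≤
      2 ^ (p - 1) * 2 ^ (p - 1) * Q + 2 ^ (p - 1) * (ε ^ p * I) := by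
    intro ε
    have hpt : ∀ x, (T.indicator h x + ε * g x) ^ p ≤ 2 ^ (p - 1) *
        (T.indicator (fun x => 2 ^ (p - 1) * (2 ^ p * g x ^ p + ENNReal.ofReal (ρ ^ (-p)))) x +
          ε ^ p * g x ^ p) := by
      intro x
      refine (ENNReal.rpow_add_le_mul_rpow_add_rpow _ _ hp.le).trans ?_
      rw [ENNReal.mul_rpow_of_nonneg _ _ hp0.le]
      gcongr
      by_cases hx : x ∈ T
      · rw [indicator_of_mem hx, indicator_of_mem hx]
        refine (ENNReal.rpow_add_le_mul_rpow_add_rpow _ _ hp.le).trans_eq ?_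
        rw [ENNReal.mul_rpow_of_nonneg _ _ hp0.le,
          ENNReal.ofReal_rpow_of_nonneg (by positivity) hp0.le, one_div,
          Real.inv_rpow hρ.le, ← Real.rpow_neg hρ.le]
      · rw [indicator_of_notMem hx, indicator_of_notMem hx, ENNReal.zero_rpow_of_pos hp0]
    refine (lintegral_mono hpt).trans ?_
    rw [lintegral_const_mul' _ _ htwo, lintegral_add_right _ (hgp.const_mul _),
      lintegral_indicator hTm, lintegral_const_mul' _ _ htwo,
      lintegral_add_right _ measurable_const, lintegral_const_mul _ hgp,
      lintegral_const_mul _ hgp, setLIntegral_const, mul_add, ← mul_assoc]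
    gcongr
    exact add_le_add (mul_le_mul' le_rfl (lintegral_mono_set inter_subset_right)) le_rfl
  have hbound : ∀ ε : ℝ≥0∞, ε ≠ 0 → ε ≠ ∞ → variationalCapacity μ p (E ∩ closedBall x₀ ρ) Ω ≤
      2 ^ (p - 1) * 2 ^ (p - 1) * Q + 2 ^ (p - 1) * (ε ^ p * I) := by
    intro ε hε hε'
    have hG : IsUpperGradient (cutoff u x₀ ρ) (fun x => T.indicator h x + ε * g x) :=
      (hg.cutoff x₀ hρ).indicator_add hg.1 (fun x => le_max_left _ _) (a := 2)
        (K := ENNReal.ofReal (1 / ρ)) ENNReal.ofNat_ne_top ENNReal.ofReal_ne_top hε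
        (fun x => le_rfl) hTm fun x hx => by
          obtain ⟨h1, h2⟩ := mem_of_cutoff_ne_zero hρ hx
          exact ⟨huH x h1, h2⟩
    have hGfin : ∫⁻ x, (T.indicator h x + ε * g x) ^ p ∂μ < ∞ := by
      refine lt_of_le_of_lt (henergy ε) (ENNReal.add_lt_top.2 ⟨?_, ?_⟩)
      · exact (ENNReal.mul_ne_top (ENNReal.mul_ne_top htwo htwo) hQfin).lt_top
      · exact (ENNReal.mul_ne_top htwo (ENNReal.mul_ne_top
          (ENNReal.rpow_ne_top_of_nonneg hp0.le hε') hgfin)).lt_top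
    have hadm : MemNewtonianZero μ p Ω (cutoff u x₀ ρ) ∧
        (∀ x ∈ E ∩ closedBall x₀ ρ, 1 ≤ cutoff u x₀ ρ x) ∧
        IsUpperGradient (cutoff u x₀ ρ) (fun x => T.indicator h x + ε * g x) := by
      refine ⟨⟨memLp_cutoff hu.1 x₀ ρ, ⟨_, hG, hGfin⟩, fun x hx => ?_⟩, fun x hx => ?_, hG⟩
      · by_contra hne
        have := (mem_of_cutoff_ne_zero hρ hne).1
        rw [hu.2.2 x hx] at this
        norm_num at this
      · refine le_max_of_le_right (le_min (by linarith [hE x hx.1]) ?_)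
        have : dist x x₀ / ρ ≤ 1 := (div_le_one hρ).2 hx.2
        linarith
    exact iInf_le_of_le _ (iInf_le_of_le _ (iInf_le_of_le hadm
      ((setLIntegral_le_lintegral _ _).trans (henergy ε))))
  have hlim : Tendsto (fun ε : ℝ => 2 ^ (p - 1) * 2 ^ (p - 1) * Q +
      2 ^ (p - 1) * (ENNReal.ofReal ε ^ p * I)) (𝓝[>] 0) (𝓝 (2 ^ (p - 1) * 2 ^ (p - 1) * Q)) := by
    have h1 : Tendsto (fun ε : ℝ => ENNReal.ofReal ε ^ p) (𝓝[>] 0) (𝓝 0) := by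
      have h2 : Tendsto (fun ε : ℝ => ENNReal.ofReal ε) (𝓝[>] 0) (𝓝 0) := by
        have h3 := ENNReal.tendsto_ofReal (tendsto_id (α := ℝ) (x := 𝓝 0))
        rw [ENNReal.ofReal_zero] at h3
        exact h3.mono_left nhdsWithin_le_nhds
      have h4 := h2.ennrpow_const p
      rwa [ENNReal.zero_rpow_of_pos hp0] at h4
    have h2 := ENNReal.Tendsto.const_mul (ENNReal.Tendsto.mul_const h1 (Or.inr hgfin))
      (a := 2 ^ (p - 1)) (Or.inr htwo)
    rw [zero_mul, mul_zero] at h2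
    simpa using tendsto_const_nhds.add h2
  refine ge_of_tendsto hlim ?_
  filter_upwards [self_mem_nhdsWithin] with ε hε
  exact hbound _ (by simpa using hε) ENNReal.ofReal_ne_top

/-- Summing the local estimates: the bounded overlap handles the energy, and the weak-type Hardy
inequality the measures of the sets `{u > 1/2} ∩ 2B`. -/
theorem IsWhitneyCover.tsum_variationalCapacity_le {μ : Measure X} (hμ : BallsPosFinite μ)
    {p : ℝ} (hp : 1 < p) {Ω S : Set X} (hΩ : IsOpen Ω) (hne : Ωᶜ.Nonempty) {c : ℝ} (hc : 0 < c)
    (hc1 : c ≤ 1 / 4) {N : ℕ} (hS : IsWhitneyCover Ω c N S) {M A₀ : ℝ≥0∞}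
    (hM : ∀ y, ∑' x : S, (closedBall (x : X) (2 * (c * infDist (x : X) Ωᶜ))).indicator
      (1 : X → ℝ≥0∞) y ≤ M) {E : Set X} {u : X → ℝ} {g : X → ℝ≥0∞}
    (hu : MemNewtonianZero μ p Ω u) (hE : ∀ x ∈ E, 1 ≤ u x) (hg : IsUpperGradient u g)
    (hgfin : ∫⁻ x, g x ^ p ∂μ ≠ ∞)
    (hA₀ : hardyMeasure μ Ωᶜ p {x | 1 / 2 < u x} ≤ A₀ * ∫⁻ x, g x ^ p ∂μ) :
    ∑' x : S, variationalCapacity μ p (E ∩ whitneyBall Ω c (x : X)) Ω ≤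
      2 ^ (p - 1) * 2 ^ (p - 1) * (2 ^ p * M + ENNReal.ofReal ((c / 2) ^ (-p)) * (M * A₀)) *
        ∫⁻ x, g x ^ p ∂μ := by
  have hp0 : 0 < p := by linarith
  have := hS.countable.to_subtype
  have hd : ∀ x : S, 0 < infDist (x : X) Ωᶜ := fun x =>
    (hΩ.isClosed_compl.notMem_iff_infDist_pos hne).1 fun h => h (hS.subset x.2)
  set I := ∫⁻ x, g x ^ p ∂μ
  set ν := hardyMeasure μ Ωᶜ p with hν
  set B : S → Set X := fun x => closedBall (x : X) (2 * (c * infDist (x : X) Ωᶜ)) with hB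
  have hBm : ∀ x, MeasurableSet (B x) := fun x => measurableSet_closedBall
  -- a Borel hull of the set `{u > 1/2}`, which is only `μ`-measurable
  set H := toMeasurable μ {x | 1 / 2 < u x} with hH
  have hHm : MeasurableSet H := measurableSet_toMeasurable _ _
  have hνH : ν H ≤ A₀ * I := by
    have h1 : NullMeasurableSet {x | 1 / 2 < u x} μ :=
      nullMeasurableSet_lt aemeasurable_const hu.1.1.aemeasurable
    have h2 : H =ᵐ[ν] {x | 1 / 2 < u x} :=
      (withDensity_absolutelyContinuous _ _).ae_eq h1.toMeasurable_ae_eq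
    rw [measure_congr h2]
    exact hA₀
  have hterm : ∀ x : S, variationalCapacity μ p (E ∩ whitneyBall Ω c (x : X)) Ω ≤
      2 ^ (p - 1) * 2 ^ (p - 1) * (2 ^ p * ∫⁻ y in B x, g y ^ p ∂μ +
        ENNReal.ofReal ((c / 2) ^ (-p)) * ∫⁻ y in B x, H.indicator 1 y ∂ν) := by
    intro x
    have hx := hd x
    refine (variationalCapacity_inter_closedBall_le hμ hp hu hE hg hgfin hHm
      (fun y hy => subset_toMeasurable _ _ hy) x (mul_pos hc hx)).trans ?_
    refine mul_le_mul' le_rfl (add_le_add le_rfl ?_)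
    change _ * μ (H ∩ B x) ≤ _
    have e1 : (c * infDist (x : X) Ωᶜ) ^ (-p) =
        (c / 2) ^ (-p) * (2 * infDist (x : X) Ωᶜ) ^ (-p) := by
      rw [← Real.mul_rpow (by positivity) (by positivity)]
      congr 1; ring
    rw [e1, ENNReal.ofReal_mul (by positivity), mul_assoc, lintegral_indicator_one hHm,
      Measure.restrict_apply hHm]
    gcongr
    refine le_hardyMeasure hp0.le (hHm.inter (hBm x)) (fun y hy => ?_) fun y hy => ?_
    · linarith [(infDist_le_and_le_of_mem_closedBall hc1 hy.2).1]
    · linarith [(infDist_le_and_le_of_mem_closedBall hc1 hy.2).2]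
  calc ∑' x : S, variationalCapacity μ p (E ∩ whitneyBall Ω c (x : X)) Ω
      ≤ ∑' x : S, 2 ^ (p - 1) * 2 ^ (p - 1) * (2 ^ p * ∫⁻ y in B x, g y ^ p ∂μ +
        ENNReal.ofReal ((c / 2) ^ (-p)) * ∫⁻ y in B x, H.indicator 1 y ∂ν) :=
        ENNReal.tsum_le_tsum hterm
    _ = 2 ^ (p - 1) * 2 ^ (p - 1) * (2 ^ p * ∑' x : S, ∫⁻ y in B x, g y ^ p ∂μ +
        ENNReal.ofReal ((c / 2) ^ (-p)) * ∑' x : S, ∫⁻ y in B x, H.indicator 1 y ∂ν) := by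
        rw [ENNReal.tsum_mul_left, ENNReal.tsum_add, ENNReal.tsum_mul_left, ENNReal.tsum_mul_left]
    _ ≤ 2 ^ (p - 1) * 2 ^ (p - 1) * (2 ^ p * (M * I) +
        ENNReal.ofReal ((c / 2) ^ (-p)) * (M * (A₀ * I))) := by
        gcongr
        · exact tsum_setLIntegral_le_of_overlap μ hBm hM (hg.1.pow_const p)
        · refine (tsum_setLIntegral_le_of_overlap ν hBm hM
            (measurable_one.indicator hHm)).trans ?_
          rw [lintegral_indicator_one hHm]
          gcongr
    _ = _ := by ring

end Whitney

end QuasiAdd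

theorem corollary1p4 {X : Type*} [MetricSpace X] [CompleteSpace X]
    [MeasurableSpace X] [BorelSpace X] (μ : Measure X)
    (hμ : QuasiAdd.BallsPosFinite μ) (hdoubling : QuasiAdd.IsDoubling μ)
    (hX : ¬ Bornology.IsBounded (univ : Set X))
    (p : ℝ) (hp : 1 < p) (hpoincare : QuasiAdd.SupportsPoincare μ p) :
    ∃ c₀ : ℝ, 0 < c₀ ∧
      ∀ Ω : Set X, IsOpen Ω → Ωᶜ.Nonempty →
        ENNReal.ofReal p < QuasiAdd.lowerAssouadCodim μ Ωᶜ →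
          ∀ c : ℝ, 0 < c → c ≤ c₀ → ∀ N : ℕ, ∃ A : ℝ≥0, ∀ S : Set X,
            QuasiAdd.IsWhitneyCover Ω c N S → QuasiAdd.IsQuasiadditive μ p Ω c S A := by
  refine ⟨1 / 4, by norm_num, fun Ω hΩ hne hcodim c hc hc1 N => ?_⟩
  have hp0 : 0 < p := by linarith
  obtain ⟨t, K, hpt, hK⟩ := QuasiAdd.exists_codimBound hp0.le hcodim
  obtain ⟨A₀, hA₀⟩ := hK.exists_hardyMeasure_superlevel_le hμ hdoubling hp hpoincare
    hΩ.isClosed_compl hne hpt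
  obtain ⟨C, hC⟩ := hdoubling
  set A : ℝ≥0∞ := 2 ^ (p - 1) * 2 ^ (p - 1) * (2 ^ p * (C ^ 4 * N) +
    ENNReal.ofReal ((c / 2) ^ (-p)) * (C ^ 4 * N * A₀)) with hA
  have hAfin : A ≠ ∞ := by
    have h1 : (2 : ℝ≥0∞) ^ (p - 1) ≠ ∞ :=
      ENNReal.rpow_ne_top_of_nonneg (by linarith) ENNReal.ofNat_ne_top
    have h2 : (2 : ℝ≥0∞) ^ p ≠ ∞ := ENNReal.rpow_ne_top_of_nonneg hp0.le ENNReal.ofNat_ne_top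
    have h3 : (C : ℝ≥0∞) ^ 4 * N ≠ ∞ :=
      ENNReal.mul_ne_top (ENNReal.pow_ne_top ENNReal.coe_ne_top) (ENNReal.natCast_ne_top N)
    exact ENNReal.mul_ne_top (ENNReal.mul_ne_top h1 h1) (ENNReal.add_ne_top.2
      ⟨ENNReal.mul_ne_top h2 h3, ENNReal.mul_ne_top ENNReal.ofReal_ne_top
        (ENNReal.mul_ne_top h3 ENNReal.coe_ne_top)⟩)
  -- the summand `1` excludes the product `0 * ∞ = 0` for sets of infinite capacity
  refine ⟨A.toNNReal + 1, fun S hS E _ => ?_⟩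
  have hA1 : ((A.toNNReal + 1 : ℝ≥0) : ℝ≥0∞) = A + 1 := by
    rw [ENNReal.coe_add, ENNReal.coe_toNNReal hAfin, ENNReal.coe_one]
  have hA0 : A + 1 ≠ 0 := by simp
  have hA1fin : A + 1 ≠ ∞ := by simp [hAfin]
  rw [hA1]
  conv_rhs => rw [QuasiAdd.variationalCapacity]
  simp only [ENNReal.mul_iInf_of_ne hA0 hA1fin]
  refine le_iInf fun u => le_iInf fun g => le_iInf fun ⟨hu, hE, hg⟩ => ?_
  -- the complement of `Ω` is a null set
  have hΩg : ∫⁻ x in Ω, g x ^ p ∂μ = ∫⁻ x, g x ^ p ∂μ := by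
    rw [setLIntegral_congr (t := univ), setLIntegral_univ]
    rw [ae_eq_univ]
    exact hK.measure_eq_zero hμ (hp0.trans hpt)
  rw [hΩg]
  by_cases hgfin : ∫⁻ x, g x ^ p ∂μ = ∞
  · rw [hgfin, ENNReal.mul_top hA0]; exact le_top
  refine (hS.tsum_variationalCapacity_le hμ hp hΩ hne hc hc1
    (hS.tsum_indicator_double_le hμ hC hΩ hne hc hc1) hu hE hg hgfin (hA₀ u g hu.1 hg)).trans ?_
  gcongr
  exact le_self_add
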